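/- Let $n$ be an odd positive integer, let $k\ge 0$ be an integer with $\gcd(k,n)=1$, let $L=GF(2^n)$, and let $f,g:L\to L$ be $$f(x)=x^{2^{2k}-2^k+1},\qquad g(x)=x^{2^{4k}-2^{3k}+2^{2k}-2^k+1}.$$ Fix a basis of $L$ over $GF(2)$, let $H$ be the binary $3n\times(2^n-1)$ matrix whose column indexed by $x\in L^*$ consists of the coordinates of $x$, $f(x)$ and $g(x)$ in this basis, and let $C$ be the null space of $H$, a binary linear code of length $2^n-1$. Then: 1. For all $a,b,c\in L$ that are not all zero, the generalised Walsh transform $$\sum_{x\in L}(-1)^{\mathrm{Tr}(ax+bf(x)+cg(x))}$$ takes one of the values $0,\ \pm 2^{(n+1)/2},\ \pm 2^{(n+3)/2}$, where $\mathrm{Tr}$ is the absolute trace $L\to GF(2)$. 2. If $n\ge 3$, the code $C$ has minimum distance $7$, i.e. it is triple-error-correcting; if $n\ge 5$, it has parameters $[2^n-1,\ 2^n-3n-1,\ 7]$. 3. $C$ has the same weight distribution as the triple-error-correcting BCH code, that is, the code constructed in the same way from the pair $x^3,\ x^5$: for every $w$ the two codes have the same number of words of weight $w$. -/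

import Mathlib

namespace TripleCode

/-- The power function `x ↦ x ^ (2^(2k) - 2^k + 1)`. No subtraction in the exponent truncates. -/
def powF {L : Type*} [Field L] (k : ℕ) (x : L) : L :=
  x ^ (2 ^ (2 * k) - 2 ^ k + 1)

/-- The power function `x ↦ x ^ (2^(4k) - 2^(3k) + 2^(2k) - 2^k + 1)`. No subtraction in the
exponent truncates. -/
def powG {L : Type*} [Field L] (k : ℕ) (x : L) : L :=
  x ^ (2 ^ (4 * k) - 2 ^ (3 * k) + 2 ^ (2 * k) - 2 ^ k + 1)

/-- The binary `3n × (2^n - 1)` matrix whose column at a nonzero `x` consists of the coordinates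
of `x`, `f x`, `g x` with respect to the basis `B`. -/
noncomputable def parityCheck {L : Type*} [Field L] [Algebra (ZMod 2) L] {n : ℕ}
    (B : Module.Basis (Fin n) (ZMod 2) L) (f g : L → L) :
    Matrix (Fin 3 × Fin n) Lˣ (ZMod 2) :=
  Matrix.of fun r x => B.repr ((![(x : L), f (x : L), g (x : L)] : Fin 3 → L) r.1) r.2

/-- The binary code of length `2^n - 1` which is the null space of the parity-check matrix. -/
noncomputable def code {L : Type*} [Field L] [Fintype L] [DecidableEq L] [Algebra (ZMod 2) L]
    {n : ℕ} (B : Module.Basis (Fin n) (ZMod 2) L) (f g : L → L) :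
    Submodule (ZMod 2) (Lˣ → ZMod 2) :=
  LinearMap.ker (parityCheck B f g).mulVecLin

/-- The primitive binary BCH code of designed distance `7`, given by the pair `x^3`, `x^5`. -/
noncomputable def bchCode {L : Type*} [Field L] [Fintype L] [DecidableEq L] [Algebra (ZMod 2) L]
    {n : ℕ} (B : Module.Basis (Fin n) (ZMod 2) L) : Submodule (ZMod 2) (Lˣ → ZMod 2) :=
  code B (fun x => x ^ 3) (fun x => x ^ 5)

/-- `d` is the minimum Hamming distance between two distinct words of `C`
(in particular, two distinct words exist). -/
def HasMinDist {ι : Type*} [Fintype ι] (C : Submodule (ZMod 2) (ι → ZMod 2)) (d : ℕ) : Prop :=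
  IsLeast {m : ℕ | ∃ u ∈ C, ∃ v ∈ C, u ≠ v ∧ hammingDist u v = m} d

/-- `C` is a binary linear `[N, κ, d]` code: length `N`, dimension `κ`, minimum distance `d`. -/
def HasParameters {ι : Type*} [Fintype ι] (C : Submodule (ZMod 2) (ι → ZMod 2)) (N κ d : ℕ) :
    Prop :=
  Fintype.card ι = N ∧ Module.finrank (ZMod 2) C = κ ∧ HasMinDist C d

/-- The number of words of `C` of Hamming weight `w`. -/
noncomputable def weightCount {ι : Type*} [Fintype ι] (C : Submodule (ZMod 2) (ι → ZMod 2))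
    (w : ℕ) : ℕ :=
  Set.ncard {u : ι → ZMod 2 | u ∈ C ∧ hammingNorm u = w}

/-- The generalised Fourier (Walsh) transform
`∑ x, (-1) ^ Tr (a x + b f(x) + c g(x))`, with `Tr` the absolute trace. -/
noncomputable def fourier {L : Type*} [Field L] [Fintype L] [Algebra (ZMod 2) L]
    (f g : L → L) (a b c : L) : ℤ :=
  ∑ x : L, (-1 : ℤ) ^ (Algebra.trace (ZMod 2) L (a * x + b * f x + c * g x)).val

end TripleCode

/-! Write σ for x ↦ x^(2^k), N = 2^n and s = 2^((n+1)/2). As gcd(2k,n) = 1, σ² fixes only 0 and 1,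
so x ↦ xσ(x) is a bijection of L. It turns the Walsh sum into the exponential sum of the quadratic
form Q(x) = Tr(a xσx + b xσ³x + c xσ⁵x). Such a sum is 0, or Q vanishes on the radical and the sum
is ±2^((n+r)/2), with r the dimension of the radical; r is odd since n is. The radical is the kernel
of a polynomial of degree 5 in σ², so r ≤ 5 (`finrank_le_of_sum_pow_eq_zero`).

The crux is to exclude r = 5. If Q vanishes on the radical, so does a second form F
(`concomitant_eq_zero`): σ fixes F(x), so F(x) is 0 or 1, and its trace is Q(x) = 0. But F is
bilinear in the σ²-conjugates of σx and of x, with a nonsingular 5 × 5 matrix. Its Gram matrix on a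
basis of a 5-dimensional radical is alternating of odd size, hence singular, yet it factors into
nonsingular matrices (`not_forall_conj_form_eq_zero`). If c = 0 the same argument in size 3 leaves
only r = 1.

All about the code follows from these values (`WalshBound`), which the BCH pair shares. The values
for c = 0 fix the fourth moment, so zero-sum quadruples of columns are only those that cancel in
pairs. All nonzero transform values satisfy z⁶ = 10Nz⁴ − 16N²z², so the sixth moment gives the same
for sextuples: no nonzero codeword has weight below 7. The moments up to order 4 then agree for both
pairs and determine the distribution of the five possible values, hence, by character sums as in
MacWilliams' identity, the weight distribution. A word of weight 7 comes from a 3-dimensional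
subspace in the BCH code. -/

/-! ### Polynomials in an automorphism, Moore matrices and alternating matrices -/

open Finset Module in
/-- A nonzero polynomial of degree at most `d` in a field automorphism `τ` whose fixed field is
`{0, 1}` vanishes on a space of dimension at most `d`. -/
theorem finrank_le_of_sum_pow_eq_zero {L : Type*} [Field L] [Finite L] [Algebra (ZMod 2) L]
    (τ : L ≃ₐ[ZMod 2] L) (hτ : ∀ x, τ x = x → x = 0 ∨ x = 1) (d : ℕ) :
    ∀ (l : ℕ → L) (R : Submodule (ZMod 2) L),
      (∀ u ∈ R, ∑ j ∈ range (d + 1), l j * (τ ^ j) u = 0) → (∃ j ≤ d, l j ≠ 0) →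
      finrank (ZMod 2) R ≤ d := by
  induction d with
  | zero =>
    rintro l R hR ⟨j, hj, hl⟩
    obtain rfl : j = 0 := by omega
    have : R = ⊥ := by
      rw [Submodule.eq_bot_iff]
      intro u hu
      simpa [hl] using hR u hu
    simp [this]
  | succ d ih =>
    rintro l R hR ⟨j, hj, hl⟩
    by_cases hbot : R = ⊥
    · rw [hbot, finrank_bot]; omega
    obtain ⟨v, hvR, hv⟩ := Submodule.exists_mem_ne_zero_of_ne_bot hbot
    -- On `R` this kills only 0 and `v`, as `v⁻¹ * u` must be fixed by `τ`; so passing to the image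
    -- costs at most one dimension.
    let φ : L →ₗ[ZMod 2] L :=
      (τ.toLinearMap - LinearMap.id) ∘ₗ LinearMap.mulLeft (ZMod 2) v⁻¹
    have hφ : ∀ u, φ u = τ (v⁻¹ * u) - v⁻¹ * u := fun u => rfl
    have hker : finrank (ZMod 2) (LinearMap.ker (φ.domRestrict R)) ≤ 1 := by
      refine finrank_le_one ⟨⟨v, hvR⟩, ?_⟩ ?_
      · rw [LinearMap.mem_ker, LinearMap.domRestrict_apply, hφ]
        simp [hv]
      · rintro ⟨⟨w, hwR⟩, hw⟩
        rw [LinearMap.mem_ker, LinearMap.domRestrict_apply, hφ] at hw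
        rcases hτ _ (sub_eq_zero.1 hw) with h | h
        · refine ⟨0, ?_⟩
          have : w = 0 := by simpa [hv] using h
          ext; simp [this]
        · refine ⟨1, ?_⟩
          have : w = v := by rw [inv_mul_eq_one₀ hv] at h; exact h.symm
          ext; simp [this]
    have hrk := LinearMap.finrank_range_add_finrank_ker (φ.domRestrict R)
    rw [LinearMap.range_domRestrict] at hrk
    suffices finrank (ZMod 2) (R.map φ) ≤ d by omega
    set μ : ℕ → L := fun j => l j * (τ ^ j) v with hμ
    have hμ0 : ∑ j ∈ range (d + 2), μ j = 0 := hR v hvR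
    -- Abel summation: since the `μ i` sum to zero, ∑ μ_i τ^i y = ∑ μ_i (τ^i y − y), which is a
    -- polynomial of degree `d` in `τ` applied to τy − y, with the tails of `μ` as coefficients.
    refine ih (fun j => ∑ i ∈ Ico (j + 1) (d + 2), μ i) _ ?_ ?_
    · rintro _ ⟨u, hu, rfl⟩
      set y := v⁻¹ * u with hy
      have hu' : u = v * y := by rw [hy, mul_inv_cancel_left₀ hv]
      have h1 : ∑ j ∈ range (d + 2), μ j * (τ ^ j) y = 0 := by
        rw [← hR u hu]
        refine sum_congr rfl fun j _ => ?_
        rw [hμ, mul_assoc, ← map_mul, ← hu']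
      have htel : ∀ i, (τ ^ i) y - y = ∑ j ∈ range i, (τ ^ j) (τ y - y) := by
        intro i
        have : ∀ j, (τ ^ j) (τ y - y) = (τ ^ (j + 1)) y - (τ ^ j) y := by
          intro j; rw [map_sub, pow_succ]; rfl
        simp_rw [this, sum_range_sub fun j => (τ ^ j) y, pow_zero, AlgEquiv.one_apply]
      have h2 : ∑ i ∈ range (d + 2), μ i * ∑ j ∈ range i, (τ ^ j) (τ y - y) = 0 := by
        simp_rw [← htel, mul_sub, sum_sub_distrib, h1, ← sum_mul, hμ0]; simp
      rw [← h2]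
      simp_rw [mul_sum, sum_mul]
      rw [hφ]
      refine sum_comm' fun a b => ?_
      simp only [mem_range, mem_Ico]
      omega
    · by_contra! hall
      have hz : ∀ i, 1 ≤ i → i ≤ d + 1 → μ i = 0 := by
        intro i hi hid
        have h3 := hall (i - 1) (by omega)
        simp only [Nat.sub_add_cancel hi] at h3
        rw [sum_eq_sum_Ico_succ_bot (by omega)] at h3
        rcases Nat.lt_or_ge i (d + 1) with h | h
        · have h4 := hall i (by omega)
          rwa [h4, add_zero] at h3
        · obtain rfl : i = d + 1 := by omega
          simpa using h3
      have hz0 : μ 0 = 0 := by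
        rw [sum_range_succ'] at hμ0
        rwa [sum_eq_zero fun i hi => hz (i + 1) (by omega) (by simp at hi; omega), zero_add] at hμ0
      have : μ j = 0 := by
        rcases Nat.eq_zero_or_pos j with rfl | h
        · exact hz0
        · exact hz j h hj
      exact mul_ne_zero hl ((map_ne_zero _).2 hv) this

open Module in
/-- The Moore matrix of linearly independent elements is nonsingular. -/
theorem det_moore_ne_zero {L : Type*} [Field L] [Finite L] [Algebra (ZMod 2) L]
    (τ : L ≃ₐ[ZMod 2] L) (hτ : ∀ x, τ x = x → x = 0 ∨ x = 1) {m : ℕ} (z : Fin m → L)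
    (hz : LinearIndependent (ZMod 2) z) :
    (Matrix.of fun i j : Fin m => (τ ^ (j : ℕ)) (z i)).det ≠ 0 := by
  intro h
  obtain ⟨v, hv, hvz⟩ := Matrix.exists_mulVec_eq_zero_iff.2 h
  obtain ⟨j, hj⟩ := Function.ne_iff.1 hv
  obtain ⟨d, rfl⟩ : ∃ d, m = d + 1 := ⟨m - 1, by have := j.2; omega⟩
  -- A linear relation between the columns is a polynomial of degree at most `d` in `τ` that
  -- vanishes on a space of dimension `d + 1`.
  have key := finrank_le_of_sum_pow_eq_zero τ hτ d
    (fun j => if h : j < d + 1 then v ⟨j, h⟩ else 0) (Submodule.span (ZMod 2) (Set.range z)) ?_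
    ⟨j, by have := j.2; omega, by rw [dif_pos j.2]; exact hj⟩
  · rw [finrank_span_eq_card hz, Fintype.card_fin] at key
    omega
  · intro u hu
    induction hu using Submodule.span_induction with
    | mem x hx =>
      obtain ⟨i, rfl⟩ := hx
      have := congrFun hvz i
      simp only [Matrix.mulVec, dotProduct, Matrix.of_apply, Pi.zero_apply] at this
      rw [Finset.sum_range, ← this]
      refine Finset.sum_congr rfl fun j _ => ?_
      rw [dif_pos j.2, mul_comm]
    | zero => simp
    | add x y _ _ hx hy => simp only [map_add, mul_add, Finset.sum_add_distrib, hx, hy, add_zero]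
    | smul a x _ hx =>
      simp only [map_smul, mul_smul_comm, ← Finset.smul_sum, hx, smul_zero]

/-- An alternating matrix of odd size over a ring of characteristic two is singular. -/
theorem Matrix.det_eq_zero_of_alternating_of_odd {R : Type*} [CommRing R] [CharP R 2] {m : ℕ}
    (hm : Odd m) (M : Matrix (Fin m) (Fin m) R) (hdiag : ∀ i, M i i = 0)
    (hsymm : ∀ i j, M i j = M j i) : M.det = 0 := by
  rw [Matrix.det_apply]
  -- In the Leibniz expansion σ and σ⁻¹ give equal terms, which cancel. A permutation with σ = σ⁻¹
  -- fixes one of the oddly many points and so picks up a zero diagonal entry.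
  refine Finset.sum_involution (fun σ _ => σ⁻¹) ?_ ?_ (fun _ _ => Finset.mem_univ _) (by simp)
  · intro σ _
    have : ∏ i, M (σ⁻¹ i) i = ∏ i, M (σ i) i := by
      rw [← Equiv.prod_comp σ]
      simp [hsymm]
    rw [Equiv.Perm.sign_inv, this]
    exact CharTwo.add_self_eq_zero _
  · intro σ _ hne hσ
    apply hne
    have : ∃ i, σ i = i := by
      refine Equiv.Perm.exists_fixed_point_of_prime (p := 2) (n := 1) ?_ ?_
      · rw [Fintype.card_fin]; exact hm.not_two_dvd_nat
      · rw [pow_one, pow_two]; exact mul_eq_one_iff_inv_eq.2 hσ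
    obtain ⟨i, hi⟩ := this
    rw [Finset.prod_eq_zero (Finset.mem_univ i) (by rw [hi, hdiag]), smul_zero]

/-! ### Exponential sums of binary quadratic forms -/

namespace TripleCode

/-- The sign `(-1) ^ z` of a bit `z`. -/
def sgn (z : ZMod 2) : ℤ := (-1) ^ z.val

theorem sgn_zero : sgn 0 = 1 := rfl

theorem sgn_one : sgn 1 = -1 := rfl

theorem sgn_add : ∀ z w : ZMod 2, sgn (z + w) = sgn z * sgn w := by decide

theorem sgn_mul_self : ∀ z : ZMod 2, sgn z * sgn z = 1 := by decide

theorem eq_zero_or_one : ∀ z : ZMod 2, z = 0 ∨ z = 1 := by decide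

section Trace

variable {L : Type*} [Field L] [Fintype L] [Algebra (ZMod 2) L]

/-- The absolute trace. -/
noncomputable abbrev tr : L →ₗ[ZMod 2] ZMod 2 := Algebra.trace (ZMod 2) L

theorem exists_tr_mul_eq_one {y : L} (hy : y ≠ 0) : ∃ x, tr (x * y) = 1 := by
  obtain ⟨b, hb⟩ : ∃ b, tr (y * b) ≠ 0 := by
    by_contra! h
    refine hy ((traceForm_nondegenerate (ZMod 2) L).1 y fun x => ?_)
    exact h x
  exact ⟨b, by rw [mul_comm]; exact (eq_zero_or_one _).resolve_left hb⟩

open Classical in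
theorem sum_sgn_tr (y : L) :
    ∑ x : L, sgn (tr (x * y)) = if y = 0 then (Fintype.card L : ℤ) else 0 := by
  split_ifs with h
  · simp [h, sgn_zero]
  · obtain ⟨b, hb⟩ := exists_tr_mul_eq_one h
    have := Equiv.sum_comp (Equiv.addRight b) fun x : L => sgn (tr (x * y))
    simp only [Equiv.coe_addRight, add_mul, map_add, sgn_add, hb, sgn_one, ← Finset.sum_mul] at this
    linarith

open Module in
/-- The square of the exponential sum of a binary quadratic form on a finite field. -/
theorem sum_sgn_quadratic (Q : L → ZMod 2) (Λ : L →ₗ[ZMod 2] L)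
    (hQ : ∀ x y, Q (x + y) = Q x + Q y + tr (y * Λ x)) :
    ∑ x, sgn (Q x) = 0 ∨ (∀ u ∈ LinearMap.ker Λ, Q u = 0) ∧
      (∑ x, sgn (Q x)) ^ 2 = Fintype.card L * 2 ^ finrank (ZMod 2) (LinearMap.ker Λ) := by
  classical
  by_cases h : ∀ u ∈ LinearMap.ker Λ, Q u = 0
  · refine Or.inr ⟨h, ?_⟩
    calc (∑ x, sgn (Q x)) ^ 2 = ∑ x, ∑ y, sgn (Q x) * sgn (Q y) := by
          rw [pow_two, Finset.sum_mul_sum]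
      _ = ∑ x, ∑ u, sgn (Q x) * sgn (Q (u + x)) :=
          Finset.sum_congr rfl fun x _ =>
            (Equiv.sum_comp (Equiv.addRight x) fun y => sgn (Q x) * sgn (Q y)).symm
      _ = ∑ u, sgn (Q u) * ∑ x, sgn (tr (x * Λ u)) := by
          rw [Finset.sum_comm]
          simp_rw [Finset.mul_sum, hQ, sgn_add]
          refine Finset.sum_congr rfl fun u _ => Finset.sum_congr rfl fun x _ => ?_
          linear_combination sgn (Q u) * sgn (tr (x * Λ u)) * sgn_mul_self (Q x)
      _ = ∑ u, if u ∈ LinearMap.ker Λ then (Fintype.card L : ℤ) else 0 := by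
          refine Finset.sum_congr rfl fun u _ => ?_
          rw [sum_sgn_tr, LinearMap.mem_ker]
          split_ifs with hu
          · rw [h u hu, sgn_zero, one_mul]
          · rw [mul_zero]
      _ = Fintype.card L * 2 ^ finrank (ZMod 2) (LinearMap.ker Λ) := by
          rw [← Finset.sum_filter, Finset.sum_const, nsmul_eq_mul, mul_comm]
          congr 1
          rw [← Fintype.card_subtype]
          have := Module.card_eq_pow_finrank (K := ZMod 2) (V := LinearMap.ker Λ)
          rw [ZMod.card] at this
          exact_mod_cast this
  · push Not at h
    -- Translation by a radical element with `Q u = 1` changes the sign of the sum.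
    obtain ⟨u, hu, hQu⟩ := h
    left
    have hQ1 := (eq_zero_or_one (Q u)).resolve_left hQu
    have := Equiv.sum_comp (Equiv.addLeft u) fun x : L => sgn (Q x)
    simp only [Equiv.coe_addLeft, hQ, hQ1, LinearMap.mem_ker.1 hu, mul_zero, map_zero, sgn_add,
      sgn_zero, sgn_one, ← Finset.sum_mul, ← Finset.mul_sum] at this
    linarith

-- The square of a nonzero sum is 2^(n+r); being a perfect square it forces n + r to be even.
open Module in
theorem sum_sgn_quadratic_of_odd {n : ℕ} (hn : Odd n) (hL : Fintype.card L = 2 ^ n)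
    (Q : L → ZMod 2) (Λ : L →ₗ[ZMod 2] L)
    (hQ : ∀ x y, Q (x + y) = Q x + Q y + tr (y * Λ x)) :
    ∑ x, sgn (Q x) = 0 ∨ (∀ u ∈ LinearMap.ker Λ, Q u = 0) ∧
      ∃ r, finrank (ZMod 2) (LinearMap.ker Λ) = r ∧ Odd r ∧
        (∑ x, sgn (Q x) = 2 ^ ((n + r) / 2) ∨ ∑ x, sgn (Q x) = -2 ^ ((n + r) / 2)) := by
  refine (sum_sgn_quadratic Q Λ hQ).imp_right fun ⟨h0, hs⟩ => ⟨h0, _, rfl, ?_⟩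
  set S := ∑ x, sgn (Q x)
  set r := finrank (ZMod 2) (LinearMap.ker Λ)
  have h1 : S.natAbs ^ 2 = 2 ^ (n + r) := by
    zify
    rw [sq_abs, hs, hL, pow_add]
    push_cast
    ring
  obtain ⟨m, -, hm⟩ := (Nat.dvd_prime_pow Nat.prime_two).1
    (h1 ▸ Dvd.intro_left _ (by rw [pow_two]) : S.natAbs ∣ 2 ^ (n + r))
  rw [hm, ← pow_mul] at h1
  have h2 := Nat.pow_right_injective le_rfl h1
  have h3 : (n + r) / 2 = m := by omega
  refine ⟨?_, ?_⟩
  · rw [Nat.odd_iff] at hn ⊢; omega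
  · rw [h3]
    rcases Int.natAbs_eq S with h | h <;> rw [h, hm] <;> simp

/-- Variant of `sum_sgn_quadratic_of_odd` with the trace pairing twisted by an automorphism. -/
theorem sum_sgn_quadratic_of_odd' {n : ℕ} (hn : Odd n) (hL : Fintype.card L = 2 ^ n)
    (Q : L → ZMod 2) (e : L ≃ₐ[ZMod 2] L) (Λ : L →ₗ[ZMod 2] L)
    (hQ : ∀ x y, Q (x + y) = Q x + Q y + tr (e y * Λ x)) :
    ∑ x, sgn (Q x) = 0 ∨ (∀ u, Λ u = 0 → Q u = 0) ∧
      ∃ r, Module.finrank (ZMod 2) (LinearMap.ker Λ) = r ∧ Odd r ∧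
        (∑ x, sgn (Q x) = 2 ^ ((n + r) / 2) ∨ ∑ x, sgn (Q x) = -2 ^ ((n + r) / 2)) := by
  have hker : LinearMap.ker (e.symm.toLinearMap ∘ₗ Λ) = LinearMap.ker Λ := by
    ext u; simp
  have := sum_sgn_quadratic_of_odd hn hL Q (e.symm.toLinearMap ∘ₗ Λ) fun x y => by
    rw [hQ, ← Algebra.trace_eq_of_algEquiv e (y * _)]
    simp
  rwa [hker] at this

end Trace

end TripleCode

/-! ### Radicals of the Kasami forms -/

namespace TripleCode

open Module Matrix in
/-- A nonsingular bilinear form of odd size in the `τ`-conjugates of `σ z` and of `z` cannot vanish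
on the diagonal of a space whose dimension is its size. -/
theorem not_forall_conj_form_eq_zero {L : Type*} [Field L] [Finite L] [Algebra (ZMod 2) L]
    (σ τ : L ≃ₐ[ZMod 2] L) (hτ : ∀ x, τ x = x → x = 0 ∨ x = 1) {m : ℕ} (hm : Odd m)
    (M : Matrix (Fin m) (Fin m) L) (hM : M.det ≠ 0) (R : Submodule (ZMod 2) L)
    (hR : finrank (ZMod 2) R = m) :
    ¬ ∀ z ∈ R, ∑ i : Fin m, ∑ j : Fin m, (τ ^ (i : ℕ)) (σ z) * M i j * (τ ^ (j : ℕ)) z = 0 := by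
  intro h
  have : CharP L 2 := charP_of_injective_algebraMap (algebraMap (ZMod 2) L).injective 2
  let bas := finBasisOfFinrankEq (ZMod 2) R hR
  let z : Fin m → L := fun i => bas i
  have hzR : ∀ i, z i ∈ R := fun i => (bas i).2
  have hz : LinearIndependent (ZMod 2) z :=
    bas.linearIndependent.map' R.subtype R.ker_subtype
  have hσz : LinearIndependent (ZMod 2) fun i => σ (z i) :=
    hz.map' σ.toLinearMap (LinearMap.ker_eq_bot.2 σ.injective)
  let b : L → L → L := fun z w =>
    ∑ i : Fin m, ∑ j : Fin m, (τ ^ (i : ℕ)) (σ z) * M i j * (τ ^ (j : ℕ)) w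
  have hadd : ∀ z w, b (z + w) (z + w) = b z z + b z w + b w z + b w w := by
    intro z w
    simp only [b, map_add, ← Finset.sum_add_distrib]
    refine Finset.sum_congr rfl fun i _ => Finset.sum_congr rfl fun j _ => ?_
    ring
  -- Symmetry of the Gram matrix comes from polarisation in characteristic 2: `b` vanishes at `z p`,
  -- `z q` and their sum.
  have hG := det_eq_zero_of_alternating_of_odd hm (of fun p q => b (z p) (z q))
    (fun p => h _ (hzR p)) (fun p q => by
      have h1 := hadd (z p) (z q)
      have h2 : b (z p) (z p) = 0 := h _ (hzR p)
      have h3 : b (z q) (z q) = 0 := h _ (hzR q)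
      have h4 : b (z p + z q) (z p + z q) = 0 := h _ (R.add_mem (hzR p) (hzR q))
      rw [h2, h3, h4, zero_add, add_zero] at h1
      exact CharTwo.add_eq_zero.1 h1.symm)
  have hfac : (of fun p q => b (z p) (z q)) =
      (of fun i j : Fin m => (τ ^ (j : ℕ)) (σ (z i))) * M *
        (of fun i j : Fin m => (τ ^ (j : ℕ)) (z i))ᵀ := by
    ext p q
    simp only [b, of_apply, mul_apply, transpose_apply, Finset.sum_mul]
    rw [Finset.sum_comm]
  rw [hfac, det_mul, det_mul, det_transpose] at hG
  exact mul_ne_zero (mul_ne_zero (det_moore_ne_zero τ hτ _ hσz) hM)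
    (det_moore_ne_zero τ hτ _ hz) hG

section Kasami

variable {L : Type*} [Field L] [Algebra (ZMod 2) L]

theorem pow_apply_pow_apply (σ : L ≃ₐ[ZMod 2] L) (i j : ℕ) (x : L) :
    (σ ^ i) ((σ ^ j) x) = (σ ^ (i + j)) x := by
  rw [pow_add]; rfl

theorem tr_pow_apply (σ : L ≃ₐ[ZMod 2] L) (i : ℕ) (x : L) : tr ((σ ^ i) x) = tr x :=
  Algebra.trace_eq_of_algEquiv (σ ^ i) x

/-- The polar form of the quadratic form `Tr (a x σ x + b x σ³ x + c x σ⁵ x)`, twisted by `σ⁵`. -/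
noncomputable def polar (σ : L ≃ₐ[ZMod 2] L) (a b c : L) : L →ₗ[ZMod 2] L :=
  LinearMap.mulLeft (ZMod 2) c + LinearMap.mulLeft (ZMod 2) ((σ ^ 2) b) ∘ₗ (σ ^ 2).toLinearMap +
    LinearMap.mulLeft (ZMod 2) ((σ ^ 4) a) ∘ₗ (σ ^ 4).toLinearMap +
    LinearMap.mulLeft (ZMod 2) ((σ ^ 5) a) ∘ₗ (σ ^ 6).toLinearMap +
    LinearMap.mulLeft (ZMod 2) ((σ ^ 5) b) ∘ₗ (σ ^ 8).toLinearMap +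
    LinearMap.mulLeft (ZMod 2) ((σ ^ 5) c) ∘ₗ (σ ^ 10).toLinearMap

theorem polar_apply (σ : L ≃ₐ[ZMod 2] L) (a b c x : L) : polar σ a b c x =
    c * x + (σ ^ 2) b * (σ ^ 2) x + (σ ^ 4) a * (σ ^ 4) x + (σ ^ 5) a * (σ ^ 6) x +
      (σ ^ 5) b * (σ ^ 8) x + (σ ^ 5) c * (σ ^ 10) x := rfl

/-- Each cross term is moved under the trace by the power of σ that turns its `y` into σ⁵y. The
coefficients of `polar` are what remains. -/
theorem tr_quadratic_add (σ : L ≃ₐ[ZMod 2] L) (a b c x y : L) :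
    tr (a * ((x + y) * (σ ^ 1) (x + y)) + b * ((x + y) * (σ ^ 3) (x + y)) +
        c * ((x + y) * (σ ^ 5) (x + y))) =
      tr (a * (x * (σ ^ 1) x) + b * (x * (σ ^ 3) x) + c * (x * (σ ^ 5) x)) +
      tr (a * (y * (σ ^ 1) y) + b * (y * (σ ^ 3) y) + c * (y * (σ ^ 5) y)) +
      tr ((σ ^ 5) y * polar σ a b c x) := by
  have h1 := tr_pow_apply σ 2 (b * (x * (σ ^ 3) y))
  have h2 := tr_pow_apply σ 4 (a * (x * (σ ^ 1) y))
  have h3 := tr_pow_apply σ 5 (a * (y * (σ ^ 1) x))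
  have h4 := tr_pow_apply σ 5 (b * (y * (σ ^ 3) x))
  have h5 := tr_pow_apply σ 5 (c * (y * (σ ^ 5) x))
  simp only [map_mul, pow_apply_pow_apply, Nat.reduceAdd] at h1 h2 h3 h4 h5
  rw [polar_apply]
  simp only [mul_add, map_add, add_mul]
  rw [mul_left_comm ((σ ^ 5) y) ((σ ^ 2) b), mul_left_comm ((σ ^ 5) y) ((σ ^ 4) a),
    mul_left_comm ((σ ^ 5) y) ((σ ^ 5) a), mul_left_comm ((σ ^ 5) y) ((σ ^ 5) b),
    mul_left_comm ((σ ^ 5) y) ((σ ^ 5) c), mul_left_comm ((σ ^ 5) y) c,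
    mul_comm ((σ ^ 5) y) ((σ ^ 2) x), mul_comm ((σ ^ 5) y) ((σ ^ 4) x),
    mul_comm ((σ ^ 5) y) x, h1, h2, h3, h4, h5]
  ring

variable [Fintype L]

/-- The trace of `1` is `1` in odd degree. -/
theorem tr_one {n : ℕ} (hn : Odd n) (hL : Fintype.card L = 2 ^ n) : tr (1 : L) = 1 := by
  have h := Algebra.trace_algebraMap (R := ZMod 2) (S := L) 1
  have hc := Module.card_eq_pow_finrank (K := ZMod 2) (V := L)
  rw [ZMod.card, hL] at hc
  rw [map_one, ← Nat.pow_right_injective le_rfl hc, nsmul_one] at h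
  rw [h, ZMod.natCast_eq_one_iff_odd.2 hn]

/-- On the radical, where the quadratic form vanishes, the symmetric concomitant of its polar form
vanishes as well. -/
theorem concomitant_eq_zero {n : ℕ} (hn : Odd n) (hL : Fintype.card L = 2 ^ n)
    (σ : L ≃ₐ[ZMod 2] L) (hσ : ∀ x, σ x = x → x = 0 ∨ x = 1) (a b c x : L)
    (hx : polar σ a b c x = 0)
    (hQ : tr (a * (x * (σ ^ 1) x) + b * (x * (σ ^ 3) x) + c * (x * (σ ^ 5) x)) = 0) :
    (σ ^ 4) a * ((σ ^ 4) x * (σ ^ 5) x) +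
      ((σ ^ 4) b * ((σ ^ 4) x * (σ ^ 7) x) + (σ ^ 3) b * ((σ ^ 3) x * (σ ^ 6) x) +
        (σ ^ 2) b * ((σ ^ 2) x * (σ ^ 5) x)) +
      ((σ ^ 4) c * ((σ ^ 4) x * (σ ^ 9) x) + (σ ^ 3) c * ((σ ^ 3) x * (σ ^ 8) x) +
        (σ ^ 2) c * ((σ ^ 2) x * (σ ^ 7) x) + (σ ^ 1) c * ((σ ^ 1) x * (σ ^ 6) x) +
        c * (x * (σ ^ 5) x)) = 0 := by
  have : CharP L 2 := charP_of_injective_algebraMap (algebraMap (ZMod 2) L).injective 2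
  set F := (σ ^ 4) a * ((σ ^ 4) x * (σ ^ 5) x) +
      ((σ ^ 4) b * ((σ ^ 4) x * (σ ^ 7) x) + (σ ^ 3) b * ((σ ^ 3) x * (σ ^ 6) x) +
        (σ ^ 2) b * ((σ ^ 2) x * (σ ^ 5) x)) +
      ((σ ^ 4) c * ((σ ^ 4) x * (σ ^ 9) x) + (σ ^ 3) c * ((σ ^ 3) x * (σ ^ 8) x) +
        (σ ^ 2) c * ((σ ^ 2) x * (σ ^ 7) x) + (σ ^ 1) c * ((σ ^ 1) x * (σ ^ 6) x) +
        c * (x * (σ ^ 5) x)) with hF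
  have hs : ∀ i y, σ ((σ ^ i) y) = (σ ^ (i + 1)) y := fun i y => by rw [pow_succ']; rfl
  have hs0 : ∀ y, σ y = (σ ^ 1) y := fun y => by rw [pow_one]
  -- The b- and c-blocks of F are sums of consecutive σ-conjugates, so σF − F telescopes; the
  -- surviving terms all contain σ⁵x and add up to σ⁵x · `polar σ a b c x`.
  have hfix : σ F = F := by
    have h2 : (2 : L) = 0 := CharTwo.two_eq_zero
    rw [hF]
    simp only [map_add, map_mul, hs, Nat.reduceAdd]
    rw [hs0 c, hs0 x]
    rw [polar_apply] at hx
    linear_combination (σ ^ 5) x * hx - h2 * (σ ^ 5) x *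
      (c * x + (σ ^ 2) b * (σ ^ 2) x + (σ ^ 4) a * (σ ^ 4) x)
  refine (hσ F hfix).resolve_right fun h1 => ?_
  -- F contains one conjugate of the a-term of Q, three of the b-term and five of the c-term. These
  -- counts are odd, so F has trace Q(x).
  have htr : tr F = 0 := by
    rw [hF]
    have hb : ∀ i, tr ((σ ^ i) b * ((σ ^ i) x * (σ ^ (i + 3)) x)) = tr (b * (x * (σ ^ 3) x)) := by
      intro i
      rw [← tr_pow_apply σ i (b * (x * (σ ^ 3) x))]
      simp only [map_mul, pow_apply_pow_apply]
    have hc : ∀ i, tr ((σ ^ i) c * ((σ ^ i) x * (σ ^ (i + 5)) x)) = tr (c * (x * (σ ^ 5) x)) := by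
      intro i
      rw [← tr_pow_apply σ i (c * (x * (σ ^ 5) x))]
      simp only [map_mul, pow_apply_pow_apply]
    have ha := tr_pow_apply σ 4 (a * (x * (σ ^ 1) x))
    simp only [map_mul, pow_apply_pow_apply, Nat.reduceAdd] at ha
    simp only [map_add] at hQ ⊢
    rw [ha, hb 4, hb 3, hb 2, hc 4, hc 3, hc 2, hc 1]
    have h2 : (2 : ZMod 2) = 0 := rfl
    linear_combination hQ + h2 * (tr (b * (x * (σ ^ 3) x)) + 2 * tr (c * (x * (σ ^ 5) x)))
  rw [h1, tr_one hn hL] at htr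
  exact one_ne_zero htr

/-- After the twist by σ⁵ only the even powers σ⁰, …, σ¹⁰ occur, so `polar` has degree 5 in σ². -/
theorem finrank_ker_polar_le (σ : L ≃ₐ[ZMod 2] L)
    (hτ : ∀ x, (σ ^ 2) x = x → x = 0 ∨ x = 1) (a b c : L) (h : ¬(a = 0 ∧ b = 0 ∧ c = 0)) :
    Module.finrank (ZMod 2) (LinearMap.ker (polar σ a b c)) ≤ 5 := by
  refine finrank_le_of_sum_pow_eq_zero (σ ^ 2) hτ 5
    (fun j => if j = 3 then (σ ^ 5) a else if j = 4 then (σ ^ 5) b else if j = 5 then (σ ^ 5) c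
      else if j = 2 then (σ ^ 4) a else if j = 1 then (σ ^ 2) b else c) _ ?_ ?_
  · intro u hu
    rw [LinearMap.mem_ker, polar_apply] at hu
    simp only [Finset.sum_range_succ, Finset.sum_range_zero, ← pow_mul]
    simpa [-AlgEquiv.coe_pow] using hu
  · by_contra! hall
    refine h ⟨?_, ?_, ?_⟩
    · simpa using hall 3
    · simpa using hall 4
    · simpa using hall 5

/-- Without c the two end terms disappear, and what is left is a cubic in σ² applied to σ²x. -/
theorem finrank_ker_polar_le_three (σ : L ≃ₐ[ZMod 2] L)
    (hτ : ∀ x, (σ ^ 2) x = x → x = 0 ∨ x = 1) (a b : L) (h : ¬(a = 0 ∧ b = 0)) :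
    Module.finrank (ZMod 2) (LinearMap.ker (polar σ a b 0)) ≤ 3 := by
  rw [← LinearEquiv.finrank_map_eq (σ ^ 2).toLinearEquiv]
  refine finrank_le_of_sum_pow_eq_zero (σ ^ 2) hτ 3
    (fun j => if j = 0 then (σ ^ 2) b else if j = 1 then (σ ^ 4) a else if j = 2 then (σ ^ 5) a
      else (σ ^ 5) b) _ ?_ ?_
  · rintro _ ⟨u, hu, rfl⟩
    rw [SetLike.mem_coe, LinearMap.mem_ker, polar_apply] at hu
    simp only [Finset.sum_range_succ, Finset.sum_range_zero, ← pow_mul]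
    simpa [-AlgEquiv.coe_pow, pow_apply_pow_apply] using hu
  · by_contra! hall
    refine h ⟨?_, ?_⟩
    · simpa using hall 2
    · simpa using hall 3

theorem finrank_ker_polar_le_one (σ : L ≃ₐ[ZMod 2] L)
    (hτ : ∀ x, (σ ^ 2) x = x → x = 0 ∨ x = 1) (a : L) (h : a ≠ 0) :
    Module.finrank (ZMod 2) (LinearMap.ker (polar σ a 0 0)) ≤ 1 := by
  rw [← LinearEquiv.finrank_map_eq (σ ^ 4).toLinearEquiv]
  refine finrank_le_of_sum_pow_eq_zero (σ ^ 2) hτ 1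
    (fun j => if j = 0 then (σ ^ 4) a else (σ ^ 5) a) _ ?_ ?_
  · rintro _ ⟨u, hu, rfl⟩
    rw [SetLike.mem_coe, LinearMap.mem_ker, polar_apply] at hu
    simp only [Finset.sum_range_succ, Finset.sum_range_zero, ← pow_mul]
    simpa [-AlgEquiv.coe_pow, pow_apply_pow_apply] using hu
  · by_contra! hall
    exact h (by simpa using hall 0)

/-- Every product in the concomitant pairs an odd with an even power of σ. The entry (i, j) of the
matrix is the coefficient of σ^(2i+1)x · σ^(2j)x, and the determinant is, up to sign, the product of
c, σc, …, σ⁴c. -/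
theorem finrank_ker_polar_ne_five {n : ℕ} (hn : Odd n) (hL : Fintype.card L = 2 ^ n)
    (σ : L ≃ₐ[ZMod 2] L) (hτ : ∀ x, (σ ^ 2) x = x → x = 0 ∨ x = 1) (a b c : L) (h : c ≠ 0)
    (hQ : ∀ x, polar σ a b c x = 0 →
      tr (a * (x * (σ ^ 1) x) + b * (x * (σ ^ 3) x) + c * (x * (σ ^ 5) x)) = 0) :
    Module.finrank (ZMod 2) (LinearMap.ker (polar σ a b c)) ≠ 5 := by
  intro hr
  have hσ : ∀ x, σ x = x → x = 0 ∨ x = 1 := fun x hx => hτ x (by rw [pow_two]; simp [hx])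
  refine not_forall_conj_form_eq_zero σ (σ ^ 2) hτ (by decide : Odd 5)
    !![0, 0, 0, (σ ^ 1) c, 0; 0, 0, 0, (σ ^ 3) b, (σ ^ 3) c; c, (σ ^ 2) b, (σ ^ 4) a, 0, 0;
      0, (σ ^ 2) c, (σ ^ 4) b, 0, 0; 0, 0, (σ ^ 4) c, 0, 0] ?_ _ hr ?_
  · simp [Matrix.det_succ_row_zero, Fin.sum_univ_succ, Fin.succAbove, h]
  · intro x hx
    have key := concomitant_eq_zero hn hL σ hσ a b c x hx (hQ x hx)
    have hs0 : ∀ i y, (σ ^ i) (σ y) = (σ ^ (i + 1)) y := fun i y => by rw [pow_succ]; rfl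
    simp only [Fin.sum_univ_five, ← pow_mul, hs0]
    simp [-AlgEquiv.coe_pow] at key ⊢
    linear_combination key

theorem finrank_ker_polar_ne_three {n : ℕ} (hn : Odd n) (hL : Fintype.card L = 2 ^ n)
    (σ : L ≃ₐ[ZMod 2] L) (hτ : ∀ x, (σ ^ 2) x = x → x = 0 ∨ x = 1) (a b : L) (h : b ≠ 0)
    (hQ : ∀ x, polar σ a b 0 x = 0 →
      tr (a * (x * (σ ^ 1) x) + b * (x * (σ ^ 3) x) + 0 * (x * (σ ^ 5) x)) = 0) :
    Module.finrank (ZMod 2) (LinearMap.ker (polar σ a b 0)) ≠ 3 := by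
  intro hr
  have hσ : ∀ x, σ x = x → x = 0 ∨ x = 1 := fun x hx => hτ x (by rw [pow_two]; simp [hx])
  rw [← LinearEquiv.finrank_map_eq (σ ^ 2).toLinearEquiv] at hr
  refine not_forall_conj_form_eq_zero σ (σ ^ 2) hτ (by decide : Odd 3)
    !![0, 0, (σ ^ 3) b; (σ ^ 2) b, (σ ^ 4) a, 0; 0, (σ ^ 4) b, 0] ?_ _ hr ?_
  · simp [Matrix.det_fin_three, h]
  · rintro _ ⟨x, hx, rfl⟩
    have key := concomitant_eq_zero hn hL σ hσ a b 0 x hx (hQ x hx)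
    have hs0 : ∀ i y, (σ ^ i) (σ y) = (σ ^ (i + 1)) y := fun i y => by rw [pow_succ]; rfl
    simp only [Fin.sum_univ_three, ← pow_mul, hs0]
    have hs1 : ∀ i y, σ ((σ ^ i) y) = (σ ^ (i + 1)) y := fun i y => by rw [pow_succ']; rfl
    simp [-AlgEquiv.coe_pow, pow_apply_pow_apply, hs1] at key ⊢
    linear_combination key

end Kasami
end TripleCode

/-! ### Walsh spectra of the Kasami and BCH pairs -/

namespace TripleCode

section Walsh

variable {L : Type*} [Field L] [Fintype L] [Algebra (ZMod 2) L]

/-- The Frobenius automorphism `x ↦ x ^ 2`. -/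
noncomputable abbrev frob (L : Type*) [Field L] [Fintype L] [Algebra (ZMod 2) L] :
    L ≃ₐ[ZMod 2] L :=
  FiniteField.frobeniusAlgEquivOfAlgebraic (ZMod 2) L

theorem frob_pow_apply (m : ℕ) (x : L) : (frob L ^ m) x = x ^ 2 ^ m := by
  have := congrFun (FiniteField.coe_frobeniusAlgEquivOfAlgebraic_iterate (ZMod 2) L m) x
  rw [ZMod.card] at this
  rw [AlgEquiv.coe_pow]
  exact this

theorem eq_zero_or_one_of_frob_pow {n m : ℕ} (hL : Fintype.card L = 2 ^ n)
    (hmn : Nat.Coprime m n) (x : L) (hx : (frob L ^ m) x = x) : x = 0 ∨ x = 1 := by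
  have h1 : Function.IsPeriodicPt (frob L) m x := by
    rw [AlgEquiv.coe_pow] at hx; exact hx
  have h2 : Function.IsPeriodicPt (frob L) n x := by
    have h := frob_pow_apply n x
    rw [← hL, FiniteField.pow_card, AlgEquiv.coe_pow] at h
    exact h
  have h3 := h1.gcd h2
  rw [hmn] at h3
  have h4 : x ^ 2 = x := by
    have h := frob_pow_apply 1 x
    rw [pow_one, pow_one] at h
    rw [← h]; exact h3
  have h5 : x * (x - 1) = 0 := by linear_combination h4
  rcases mul_eq_zero.1 h5 with h | h
  · exact Or.inl h
  · exact Or.inr (sub_eq_zero.1 h)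

theorem sum_sgn_kasami_form {n : ℕ} (hn : Odd n) (hL : Fintype.card L = 2 ^ n)
    (σ : L ≃ₐ[ZMod 2] L) (hτ : ∀ x, (σ ^ 2) x = x → x = 0 ∨ x = 1) (a b c : L)
    (h : ¬(a = 0 ∧ b = 0 ∧ c = 0)) :
    ∑ x, sgn (tr (a * (x * (σ ^ 1) x) + b * (x * (σ ^ 3) x) + c * (x * (σ ^ 5) x))) ∈
        ({0, 2 ^ ((n + 1) / 2), -2 ^ ((n + 1) / 2)} : Set ℤ) ∨ c ≠ 0 ∧
    ∑ x, sgn (tr (a * (x * (σ ^ 1) x) + b * (x * (σ ^ 3) x) + c * (x * (σ ^ 5) x))) ∈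
        ({2 ^ ((n + 3) / 2), -2 ^ ((n + 3) / 2)} : Set ℤ) := by
  rcases sum_sgn_quadratic_of_odd' hn hL
    (fun x => tr (a * (x * (σ ^ 1) x) + b * (x * (σ ^ 3) x) + c * (x * (σ ^ 5) x))) (σ ^ 5) (polar σ a b c)
    (tr_quadratic_add σ a b c) with h0 | ⟨hQ, r, hr, hodd, hS⟩
  · left; rw [h0]; simp
  have hr5 : r ≤ 5 := hr ▸ finrank_ker_polar_le σ hτ a b c h
  have hcases : r = 1 ∨ r = 3 ∧ c ≠ 0 := by
    by_cases hc : c = 0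
    · subst hc
      left
      have hab : ¬(a = 0 ∧ b = 0) := fun hab => h ⟨hab.1, hab.2, rfl⟩
      have hr3 : r ≤ 3 := hr ▸ finrank_ker_polar_le_three σ hτ a b hab
      by_cases hb : b = 0
      · subst hb
        have hr1 : r ≤ 1 := hr ▸ finrank_ker_polar_le_one σ hτ a fun ha => hab ⟨ha, rfl⟩
        rw [Nat.odd_iff] at hodd; omega
      · have := finrank_ker_polar_ne_three hn hL σ hτ a b hb hQ
        rw [hr] at this
        rw [Nat.odd_iff] at hodd; omega
    · have := finrank_ker_polar_ne_five hn hL σ hτ a b c hc hQ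
      rw [hr] at this
      rw [Nat.odd_iff] at hodd
      have : r = 1 ∨ r = 3 := by omega
      exact this.imp_right fun h => ⟨h, hc⟩
  rcases hcases with rfl | ⟨rfl, hc⟩
  · left; rcases hS with hS | hS <;> rw [hS] <;> simp
  · right; refine ⟨hc, ?_⟩; rcases hS with hS | hS <;> rw [hS] <;> simp

/-- With q = 2^k this is (q + 1)(q² − q + 1) = q³ + 1. -/
theorem powF_mul (k : ℕ) (x : L) :
    powF k (x * (frob L ^ k) x) = x * ((frob L ^ k) ^ 3) x := by
  rw [← pow_mul, frob_pow_apply, frob_pow_apply, powF, ← pow_succ', ← pow_succ', ← pow_mul]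
  congr 1
  have h : 2 ^ k ≤ 2 ^ (2 * k) := Nat.pow_le_pow_right (by norm_num) (by omega)
  zify [h]
  ring

/-- With q = 2^k this is (q + 1)(q⁴ − q³ + q² − q + 1) = q⁵ + 1. -/
theorem powG_mul (k : ℕ) (x : L) :
    powG k (x * (frob L ^ k) x) = x * ((frob L ^ k) ^ 5) x := by
  rw [← pow_mul, frob_pow_apply, frob_pow_apply, powG, ← pow_succ', ← pow_succ', ← pow_mul]
  congr 1
  have h1 : 2 ^ (3 * k) ≤ 2 ^ (4 * k) := Nat.pow_le_pow_right (by norm_num) (by omega)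
  have h2 : 2 ^ k ≤ 2 ^ (2 * k) := Nat.pow_le_pow_right (by norm_num) (by omega)
  zify [h1, h2.trans (Nat.le_add_left _ (2 ^ (4 * k) - 2 ^ (3 * k)))]
  ring

/-- If xσx = yσy with y ≠ 0, then t = x/y has tσt = 1. Applying σ gives σ²t = t, so t = 1. -/
theorem bijective_mul_apply (σ : L ≃ₐ[ZMod 2] L)
    (hτ : ∀ x, (σ ^ 2) x = x → x = 0 ∨ x = 1) :
    Function.Bijective fun x : L => x * σ x := by
  refine Finite.injective_iff_bijective.1 fun x y hxy => ?_
  change x * σ x = y * σ y at hxy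
  by_cases hy : y = 0
  · subst hy
    simpa using hxy
  have hσy : σ y ≠ 0 := (map_ne_zero σ).2 hy
  have ht : x / y * σ (x / y) = 1 := by
    rw [map_div₀]
    field_simp
    exact hxy
  have ht' := congrArg σ ht
  rw [map_mul, map_one] at ht'
  have hne : σ (x / y) ≠ 0 := right_ne_zero_of_mul_eq_one ht
  have h2 : (σ ^ 2) (x / y) = x / y := by
    rw [pow_two]
    refine mul_left_cancel₀ hne ?_
    rw [AlgEquiv.mul_apply, ht', mul_comm, ht]
  rcases hτ _ h2 with h | h
  · rw [h, zero_mul] at ht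
    exact absurd ht zero_ne_one
  · exact (div_eq_one_iff_eq hy).1 h

theorem fourier_eq_sum_sgn (f g : L → L) (a b c : L) :
    fourier f g a b c = ∑ x, sgn (tr (a * x + b * f x + c * g x)) := rfl

theorem fourier_kasami {n k : ℕ} (hn : Odd n) (hk : Nat.Coprime k n)
    (hL : Fintype.card L = 2 ^ n) (a b c : L) (h : ¬(a = 0 ∧ b = 0 ∧ c = 0)) :
    fourier (powF k) (powG k) a b c ∈
        ({0, 2 ^ ((n + 1) / 2), -2 ^ ((n + 1) / 2)} : Set ℤ) ∨ c ≠ 0 ∧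
      fourier (powF k) (powG k) a b c ∈
        ({2 ^ ((n + 3) / 2), -2 ^ ((n + 3) / 2)} : Set ℤ) := by
  have hτ : ∀ x, ((frob L ^ k) ^ 2) x = x → x = 0 ∨ x = 1 := by
    intro x
    rw [← pow_mul]
    exact eq_zero_or_one_of_frob_pow hL
      (Nat.Coprime.mul_left hk (Nat.coprime_two_left.2 hn)) x
  have key := sum_sgn_kasami_form hn hL (frob L ^ k) hτ a b c h
  have heq : fourier (powF k) (powG k) a b c = ∑ x, sgn (tr (a * (x * ((frob L ^ k) ^ 1) x) +
      b * (x * ((frob L ^ k) ^ 3) x) + c * (x * ((frob L ^ k) ^ 5) x))) := by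
    rw [fourier_eq_sum_sgn, ← (bijective_mul_apply _ hτ).sum_comp]
    simp only [powF_mul, powG_mul, pow_one]
  rwa [heq]

/-- The polar form of `Tr (a x + b x³ + c x⁵)`, twisted by `x ↦ x⁴`. -/
noncomputable def bchPolar (b c : L) : L →ₗ[ZMod 2] L :=
  LinearMap.mulLeft (ZMod 2) c +
    LinearMap.mulLeft (ZMod 2) ((frob L ^ 1) b) ∘ₗ (frob L ^ 1).toLinearMap +
    LinearMap.mulLeft (ZMod 2) ((frob L ^ 2) b) ∘ₗ (frob L ^ 3).toLinearMap +
    LinearMap.mulLeft (ZMod 2) ((frob L ^ 2) c) ∘ₗ (frob L ^ 4).toLinearMap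

theorem bchPolar_apply (b c x : L) : bchPolar b c x =
    c * x + (frob L ^ 1) b * (frob L ^ 1) x + (frob L ^ 2) b * (frob L ^ 3) x +
      (frob L ^ 2) c * (frob L ^ 4) x := rfl

theorem tr_bch_add (a b c x y : L) :
    tr (a * (x + y) + b * ((x + y) * (frob L ^ 1) (x + y)) +
        c * ((x + y) * (frob L ^ 2) (x + y))) =
      tr (a * x + b * (x * (frob L ^ 1) x) + c * (x * (frob L ^ 2) x)) +
      tr (a * y + b * (y * (frob L ^ 1) y) + c * (y * (frob L ^ 2) y)) +
      tr ((frob L ^ 2) y * bchPolar b c x) := by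
  have h1 := tr_pow_apply (frob L) 1 (b * (x * (frob L ^ 1) y))
  have h2 := tr_pow_apply (frob L) 2 (b * (y * (frob L ^ 1) x))
  have h3 := tr_pow_apply (frob L) 2 (c * (y * (frob L ^ 2) x))
  simp only [map_mul, pow_apply_pow_apply, Nat.reduceAdd] at h1 h2 h3
  rw [bchPolar_apply]
  simp only [mul_add, map_add, add_mul]
  rw [mul_left_comm ((frob L ^ 2) y) ((frob L ^ 1) b),
    mul_left_comm ((frob L ^ 2) y) ((frob L ^ 2) b),
    mul_left_comm ((frob L ^ 2) y) ((frob L ^ 2) c), mul_left_comm ((frob L ^ 2) y) c,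
    mul_comm ((frob L ^ 2) y) ((frob L ^ 1) x), mul_comm ((frob L ^ 2) y) x, h1, h2, h3]
  ring

theorem finrank_ker_bchPolar_le {n : ℕ} (hL : Fintype.card L = 2 ^ n) (b c : L)
    (h : ¬(b = 0 ∧ c = 0)) :
    Module.finrank (ZMod 2) (LinearMap.ker (bchPolar b c)) ≤ 4 := by
  refine finrank_le_of_sum_pow_eq_zero (frob L)
    (fun x hx => eq_zero_or_one_of_frob_pow hL (Nat.coprime_one_left n) x hx) 4
    (fun j => if j = 0 then c else if j = 1 then (frob L ^ 1) b else if j = 2 then 0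
      else if j = 3 then (frob L ^ 2) b else (frob L ^ 2) c) _ ?_ ?_
  · intro u hu
    rw [LinearMap.mem_ker, bchPolar_apply] at hu
    simpa [Finset.sum_range_succ, -AlgEquiv.coe_pow, frob_pow_apply] using hu
  · by_contra! hall
    exact h ⟨by simpa using hall 3, by simpa using hall 0⟩

theorem finrank_ker_bchPolar_le_two {n : ℕ} (hL : Fintype.card L = 2 ^ n) (b : L)
    (h : b ≠ 0) :
    Module.finrank (ZMod 2) (LinearMap.ker (bchPolar b 0)) ≤ 2 := by
  rw [← LinearEquiv.finrank_map_eq (frob L ^ 1).toLinearEquiv]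
  refine finrank_le_of_sum_pow_eq_zero (frob L)
    (fun x hx => eq_zero_or_one_of_frob_pow hL (Nat.coprime_one_left n) x hx) 2
    (fun j => if j = 0 then (frob L ^ 1) b else if j = 1 then 0 else (frob L ^ 2) b) _ ?_ ?_
  · rintro _ ⟨u, hu, rfl⟩
    rw [SetLike.mem_coe, LinearMap.mem_ker, bchPolar_apply] at hu
    have : (frob L ^ 3) u = (u ^ 2) ^ 2 ^ 2 := by rw [frob_pow_apply]; ring
    rw [this] at hu
    simpa [Finset.sum_range_succ, -AlgEquiv.coe_pow, frob_pow_apply] using hu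
  · by_contra! hall
    exact h (by simpa using hall 2)

/-- This form is quadratic without substitution, and its polar form has degree 4 in the Frobenius,
or 2 when c = 0. Parity of r alone then leaves r = 1, or r = 3 with c ≠ 0. -/
theorem fourier_bch {n : ℕ} (hn : Odd n) (hL : Fintype.card L = 2 ^ n) (a b c : L)
    (h : ¬(a = 0 ∧ b = 0 ∧ c = 0)) :
    fourier (fun x => x ^ 3) (fun x => x ^ 5) a b c ∈
        ({0, 2 ^ ((n + 1) / 2), -2 ^ ((n + 1) / 2)} : Set ℤ) ∨ c ≠ 0 ∧
      fourier (fun x => x ^ 3) (fun x => x ^ 5) a b c ∈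
        ({2 ^ ((n + 3) / 2), -2 ^ ((n + 3) / 2)} : Set ℤ) := by
  have heq : fourier (fun x => x ^ 3) (fun x => x ^ 5) a b c =
      ∑ x, sgn (tr (a * x + b * (x * (frob L ^ 1) x) + c * (x * (frob L ^ 2) x))) := by
    rw [fourier_eq_sum_sgn]
    refine Finset.sum_congr rfl fun x _ => ?_
    rw [frob_pow_apply, frob_pow_apply, ← pow_succ', ← pow_succ']
    norm_num
  rw [heq]
  rcases sum_sgn_quadratic_of_odd' hn hL
    (fun x => tr (a * x + b * (x * (frob L ^ 1) x) + c * (x * (frob L ^ 2) x))) (frob L ^ 2) (bchPolar b c)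
    (tr_bch_add a b c) with h0 | ⟨hQ, r, hr, hodd, hS⟩
  · left; rw [h0]; simp
  -- For b = c = 0 the radical is all of L, and Q would have to vanish identically.
  have hbc : ¬(b = 0 ∧ c = 0) := by
    rintro ⟨rfl, rfl⟩
    obtain ⟨x, hx⟩ := exists_tr_mul_eq_one (L := L) (y := a) fun ha => h ⟨ha, rfl, rfl⟩
    have := hQ x (by rw [bchPolar_apply]; simp)
    rw [zero_mul, zero_mul, add_zero, add_zero, mul_comm, hx] at this
    exact one_ne_zero this
  have hr4 : r ≤ 4 := hr ▸ finrank_ker_bchPolar_le hL b c hbc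
  rw [Nat.odd_iff] at hodd
  have hcases : r = 1 ∨ r = 3 ∧ c ≠ 0 := by
    by_cases hc : c = 0
    · subst hc
      have hr2 : r ≤ 2 := hr ▸ finrank_ker_bchPolar_le_two hL b fun hb => hbc ⟨hb, rfl⟩
      omega
    · have : r = 1 ∨ r = 3 := by omega
      exact this.imp_right fun h => ⟨h, hc⟩
  rcases hcases with rfl | ⟨rfl, hc⟩
  · left; rcases hS with hS | hS <;> rw [hS] <;> simp
  · right; refine ⟨hc, ?_⟩; rcases hS with hS | hS <;> rw [hS] <;> simp

end Walsh
end TripleCode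

/-! ### Zero-sum tuples as power moments -/

namespace TripleCode

section Counting

open Finset

/-- The `j`-tuples whose images under `φ` sum to zero. -/
noncomputable def zeroSumTuples {L V : Type*} [Fintype L] [AddCommMonoid V] (φ : L → V) (j : ℕ) :
    Finset (Fin j → L) :=
  open Classical in univ.filter fun x => ∑ i, φ (x i) = 0

theorem mem_zeroSumTuples {L V : Type*} [Fintype L] [AddCommMonoid V] {φ : L → V} {j : ℕ}
    {x : Fin j → L} : x ∈ zeroSumTuples φ j ↔ ∑ i, φ (x i) = 0 := by
  simp [zeroSumTuples]

/-- Power moments of exponential sums count zero-sum tuples. -/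
theorem sum_pow_eq_card_mul_card_zeroSumTuples {L V Ψ : Type*} [Fintype L] [AddCommMonoid V]
    [Fintype Ψ] (φ : L → V) (e : Ψ → V → ℤ) (h0 : ∀ ψ, e ψ 0 = 1)
    (hadd : ∀ ψ v w, e ψ (v + w) = e ψ v * e ψ w)
    (hsum : ∀ v ≠ 0, ∑ ψ, e ψ v = 0) (j : ℕ) :
    ∑ ψ, (∑ x, e ψ (φ x)) ^ j = Fintype.card Ψ * #(zeroSumTuples φ j) := by
  classical
  have hsum' : ∀ v, ∑ ψ, e ψ v = if v = 0 then (Fintype.card Ψ : ℤ) else 0 := by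
    intro v
    split_ifs with hv
    · simp [hv, h0]
    · exact hsum v hv
  have hprod : ∀ ψ (x : Fin j → L), ∏ i, e ψ (φ (x i)) = e ψ (∑ i, φ (x i)) := by
    intro ψ x
    generalize (univ : Finset (Fin j)) = s
    induction s using Finset.induction_on with
    | empty => simp [h0]
    | insert a s ha ih => rw [prod_insert ha, sum_insert ha, hadd, ih]
  simp_rw [Fintype.sum_pow, hprod]
  rw [sum_comm]
  simp_rw [hsum']
  rw [← sum_filter, sum_const, nsmul_eq_mul, mul_comm]
  congr 3

/-- The moments of a simple random walk, as sums over the subsets of a finite set. -/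
theorem sum_powerset_pow {α : Type*} [DecidableEq α] (A : Finset α) :
    ∑ S ∈ A.powerset, ((#A : ℤ) - 2 * #S) ^ 2 = (2 : ℤ) ^ #A * (#A : ℤ) ∧
    ∑ S ∈ A.powerset, ((#A : ℤ) - 2 * #S) ^ 4 = (2 : ℤ) ^ #A * (3 * (#A : ℤ) ^ 2 - 2 * #A) ∧
    ∑ S ∈ A.powerset, ((#A : ℤ) - 2 * #S) ^ 6 =
      (2 : ℤ) ^ #A * (15 * (#A : ℤ) ^ 3 - 30 * (#A : ℤ) ^ 2 + 16 * #A) := by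
  induction A using Finset.induction_on with
  | empty => simp
  | insert a A ha ih =>
    obtain ⟨h2, h4, h6⟩ := ih
    have h0 : ∑ S ∈ A.powerset, (1 : ℤ) = 2 ^ #A := by simp
    have hstep : ∀ j, ∑ S ∈ (insert a A).powerset, ((#(insert a A) : ℤ) - 2 * #S) ^ j =
        ∑ S ∈ A.powerset,
          ((((#A : ℤ) - 2 * #S) + 1) ^ j + (((#A : ℤ) - 2 * #S) - 1) ^ j) := by
      intro j
      rw [sum_powerset_insert ha, ← sum_add_distrib]
      refine sum_congr rfl fun S hS => ?_
      have haS : a ∉ S := fun h => ha (mem_powerset.1 hS h)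
      rw [card_insert_of_notMem ha, card_insert_of_notMem haS]
      push_cast
      ring
    rw [hstep, hstep, hstep, card_insert_of_notMem ha]
    have e2 : ∀ y : ℤ, (y + 1) ^ 2 + (y - 1) ^ 2 = 2 * y ^ 2 + 2 * 1 := fun y => by ring
    have e4 : ∀ y : ℤ, (y + 1) ^ 4 + (y - 1) ^ 4 = 2 * y ^ 4 + 12 * y ^ 2 + 2 * 1 :=
      fun y => by ring
    have e6 : ∀ y : ℤ, (y + 1) ^ 6 + (y - 1) ^ 6 =
        2 * y ^ 6 + 30 * y ^ 4 + 30 * y ^ 2 + 2 * 1 := fun y => by ring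
    simp_rw [e2, e4, e6, sum_add_distrib, ← mul_sum, h0, h2, h4, h6]
    push_cast
    refine ⟨?_, ?_, ?_⟩ <;> ring

section

variable {L : Type*} [DecidableEq L]

/-- The indicator function of a point, with values in `ZMod 2`. -/
def point (x : L) : L → ZMod 2 := Pi.single x 1

theorem sum_point_apply {ι : Type*} [Fintype ι] (x : ι → L) (y : L) :
    (∑ i, point (x i)) y = ∑ i, if x i = y then 1 else 0 := by
  rw [Finset.sum_apply]
  refine sum_congr rfl fun i _ => ?_
  rw [point, Pi.single_apply]
  simp [eq_comm]

variable [Fintype L]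

theorem sum_eq_sum_smul {V ι : Type*} [AddCommGroup V] [Module (ZMod 2) V] [Fintype ι]
    (φ : L → V) (x : ι → L) : ∑ i, φ (x i) = ∑ y, (∑ i, point (x i)) y • φ y := by
  simp_rw [sum_point_apply, sum_smul]
  rw [sum_comm]
  refine sum_congr rfl fun i _ => ?_
  simp

theorem zeroSumTuples_point_subset {V : Type*} [AddCommGroup V] [Module (ZMod 2) V]
    (φ : L → V) (j : ℕ) : zeroSumTuples (point (L := L)) j ⊆ zeroSumTuples φ j := by
  intro x hx
  rw [mem_zeroSumTuples] at hx ⊢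
  rw [sum_eq_sum_smul, hx]
  simp

/-- The numbers of pairs, quadruples and sextuples in which every value occurs an even number of
times. -/
theorem card_zeroSumTuples_point :
    (#(zeroSumTuples (point (L := L)) 2) : ℤ) = Fintype.card L ∧
    (#(zeroSumTuples (point (L := L)) 4) : ℤ) =
      3 * Fintype.card L ^ 2 - 2 * Fintype.card L ∧
    (#(zeroSumTuples (point (L := L)) 6) : ℤ) =
      15 * Fintype.card L ^ 3 - 30 * Fintype.card L ^ 2 + 16 * Fintype.card L := by
  classical
  -- The characters of the group of functions L → GF(2) are indexed by the subsets S of L. Their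
  -- sums over the points are |L| − 2|S|, which leads to the random-walk moments.
  have key := sum_pow_eq_card_mul_card_zeroSumTuples (Ψ := Finset L) (point (L := L))
    (fun S v => ∏ x ∈ S, sgn (v x)) (by simp [sgn_zero])
    (by intro S v w; simp [sgn_add, prod_mul_distrib]) (by
      intro v h
      rw [← powerset_univ, ← prod_one_add]
      obtain ⟨x, hx⟩ := Function.ne_iff.1 h
      refine prod_eq_zero (mem_univ x) ?_
      rw [(eq_zero_or_one (v x)).resolve_left hx, sgn_one]
      norm_num)
  have hinner : ∀ S : Finset L, ∑ x, ∏ y ∈ S, sgn (point x y) =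
      (#(univ : Finset L) : ℤ) - 2 * #S := by
    intro S
    have : ∀ x, ∏ y ∈ S, sgn (point x y) = 1 - if x ∈ S then 2 else 0 := by
      intro x
      split_ifs with hx
      · rw [prod_eq_single_of_mem x hx]
        · simp [point, sgn_one]
        · intro y _ hy
          simp [point, hy, sgn_zero]
      · rw [prod_eq_one, sub_zero]
        intro y hy
        have : y ≠ x := fun h => hx (h ▸ hy)
        simp [point, this, sgn_zero]
    simp_rw [this]
    rw [sum_sub_distrib, ← sum_filter]
    simp [mul_comm]
  simp_rw [hinner] at key
  obtain ⟨h2, h4, h6⟩ := sum_powerset_pow (univ : Finset L)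
  rw [powerset_univ] at h2 h4 h6
  have k2 := key 2
  have k4 := key 4
  have k6 := key 6
  rw [h2] at k2
  rw [h4] at k4
  rw [h6] at k6
  rw [Fintype.card_finset] at k2 k4 k6
  push_cast at k2 k4 k6
  rw [card_univ] at k2 k4 k6
  have hne : (2 : ℤ) ^ Fintype.card L ≠ 0 := by positivity
  exact ⟨(mul_left_cancel₀ hne k2).symm, (mul_left_cancel₀ hne k4).symm,
    (mul_left_cancel₀ hne k6).symm⟩

theorem card_zeroSumTuples_two {V : Type*} [AddCommGroup V] [Module (ZMod 2) V]
    {φ : L → V} (hφ : Function.Injective φ) :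
    (#(zeroSumTuples φ 2) : ℤ) = Fintype.card L := by
  rw [← card_zeroSumTuples_point.1]
  congr 2
  refine (zeroSumTuples_point_subset φ 2).antisymm' fun x hx => ?_
  rw [mem_zeroSumTuples, Fin.sum_univ_two] at hx ⊢
  have h1 : φ (x 0) = φ (x 1) := by
    have h2 : φ (x 1) + φ (x 1) = 0 := by
      rw [← two_smul (ZMod 2)]
      exact zero_smul (ZMod 2) _
    rw [← h2] at hx
    exact add_right_cancel hx
  rw [hφ h1, ← two_smul (ZMod 2)]
  exact zero_smul (ZMod 2) _

end

end Counting

/-! ### Moments and value distribution of the Walsh transform -/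

section Moments

open Finset

variable {L : Type*} [Field L] [Fintype L] [Algebra (ZMod 2) L]

/-- The Walsh transform of the pair `f, g` takes the values `0, ±2^((n+1)/2), ±2^((n+3)/2)` away
from the origin, and the last two of them only where `c ≠ 0`. -/
def WalshBound (n : ℕ) (f g : L → L) : Prop :=
  ∀ a b c : L, ¬(a = 0 ∧ b = 0 ∧ c = 0) →
    fourier f g a b c ∈ ({0, 2 ^ ((n + 1) / 2), -2 ^ ((n + 1) / 2)} : Set ℤ) ∨ c ≠ 0 ∧
      fourier f g a b c ∈ ({2 ^ ((n + 3) / 2), -2 ^ ((n + 3) / 2)} : Set ℤ)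

/-- The columns of the parity-check matrix. -/
def column (f g : L → L) (x : L) : L × L × L := (x, f x, g x)

theorem fourier_zero (f g : L → L) : fourier f g 0 0 0 = Fintype.card L := by
  simp [fourier_eq_sum_sgn, sgn_zero]

theorem sum_sgn_tr_pair {v : L × L} (hv : v ≠ 0) :
    ∑ t : L × L, sgn (tr (t.1 * v.1 + t.2 * v.2)) = 0 := by
  simp_rw [Fintype.sum_prod_type, map_add, sgn_add]
  rw [← sum_mul_sum, sum_sgn_tr, sum_sgn_tr]
  by_cases h1 : v.1 = 0
  · have h2 : v.2 ≠ 0 := fun h2 => hv (Prod.ext h1 h2)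
    rw [if_neg h2, mul_zero]
  · rw [if_neg h1, zero_mul]

theorem sum_sgn_tr_triple {v : L × L × L} (hv : v ≠ 0) :
    ∑ t : L × L × L, sgn (tr (t.1 * v.1 + t.2.1 * v.2.1 + t.2.2 * v.2.2)) = 0 := by
  simp_rw [add_assoc, map_add _ (_ * v.1), sgn_add, Fintype.sum_prod_type (α₁ := L) (α₂ := L × L)]
  rw [← sum_mul_sum univ univ (fun x => sgn (tr (x * v.1)))
    fun t : L × L => sgn (tr (t.1 * v.2.1 + t.2 * v.2.2)), sum_sgn_tr]
  by_cases h1 : v.1 = 0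
  · rw [sum_sgn_tr_pair fun h2 => hv (Prod.ext h1 h2), mul_zero]
  · rw [if_neg h1, zero_mul]

theorem sum_fourier_pow (f g : L → L) (j : ℕ) :
    ∑ t : L × L × L, fourier f g t.1 t.2.1 t.2.2 ^ j =
      Fintype.card L ^ 3 * #(zeroSumTuples (column f g) j) := by
  classical
  have := sum_pow_eq_card_mul_card_zeroSumTuples (column f g)
    (fun (t v : L × L × L) => sgn (tr (t.1 * v.1 + t.2.1 * v.2.1 + t.2.2 * v.2.2)))
    (by simp [sgn_zero])
    (by
      intro t v w
      rw [← sgn_add, ← map_add]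
      congr 2
      simp only [Prod.fst_add, Prod.snd_add]
      ring)
    (fun _ => sum_sgn_tr_triple) j
  simp only [Fintype.card_prod] at this
  push_cast at this
  rw [← pow_three] at this
  exact this

theorem sum_fourier_pow_pair (f g : L → L) (j : ℕ) :
    ∑ t : L × L, fourier f g t.1 t.2 0 ^ j =
      Fintype.card L ^ 2 * #(zeroSumTuples (fun x => (x, f x)) j) := by
  classical
  have := sum_pow_eq_card_mul_card_zeroSumTuples (fun x => (x, f x))
    (fun (t v : L × L) => sgn (tr (t.1 * v.1 + t.2 * v.2)))
    (by simp [sgn_zero])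
    (by
      intro t v w
      rw [← sgn_add, ← map_add]
      congr 2
      simp only [Prod.fst_add, Prod.snd_add]
      ring)
    (fun _ => sum_sgn_tr_pair) j
  simp only [Fintype.card_prod] at this
  push_cast at this
  rw [← pow_two] at this
  simp only [fourier_eq_sum_sgn, zero_mul, add_zero]
  exact this

theorem sq_two_pow_half {n : ℕ} (hn : Odd n) : ((2 : ℤ) ^ ((n + 1) / 2)) ^ 2 = 2 * 2 ^ n := by
  obtain ⟨m, rfl⟩ := hn
  rw [← pow_mul, ← pow_succ']
  congr 1
  omega

theorem two_pow_half {n : ℕ} (hn : Odd n) :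
    (2 : ℤ) ^ ((n + 3) / 2) = 2 * 2 ^ ((n + 1) / 2) := by
  obtain ⟨m, rfl⟩ := hn
  rw [← pow_succ']
  congr 1
  omega

variable {n : ℕ} {f g : L → L}

theorem WalshBound.mem (hn : Odd n) (h : WalshBound n f g) {a b c : L}
    (habc : ¬(a = 0 ∧ b = 0 ∧ c = 0)) :
    fourier f g a b c ∈ ({0, 2 ^ ((n + 1) / 2), -2 ^ ((n + 1) / 2), 2 * 2 ^ ((n + 1) / 2),
      -(2 * 2 ^ ((n + 1) / 2))} : Set ℤ) := by
  have := h a b c habc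
  rw [two_pow_half hn] at this
  simp only [Set.mem_insert_iff, Set.mem_singleton_iff] at this ⊢
  tauto

theorem WalshBound.pow_four (hn : Odd n) (hL : Fintype.card L = 2 ^ n) (h : WalshBound n f g)
    {a b : L} (hab : ¬(a = 0 ∧ b = 0)) :
    fourier f g a b 0 ^ 4 = 2 * Fintype.card L * fourier f g a b 0 ^ 2 := by
  have hs := sq_two_pow_half hn
  have := (h a b 0 fun h => hab ⟨h.1, h.2.1⟩).resolve_right fun h => h.1 rfl
  simp only [Set.mem_insert_iff, Set.mem_singleton_iff] at this
  rw [hL]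
  push_cast
  set s : ℤ := 2 ^ ((n + 1) / 2)
  rcases this with h | h | h <;> rw [h]
  · norm_num
  · linear_combination s ^ 2 * hs
  · linear_combination s ^ 2 * hs

/-- All five values are roots of z²(z² − 2N)(z² − 8N), where N = |L|. -/
theorem WalshBound.pow_six (hn : Odd n) (hL : Fintype.card L = 2 ^ n) (h : WalshBound n f g)
    {a b c : L} (habc : ¬(a = 0 ∧ b = 0 ∧ c = 0)) :
    fourier f g a b c ^ 6 = 10 * Fintype.card L * fourier f g a b c ^ 4 -
      16 * Fintype.card L ^ 2 * fourier f g a b c ^ 2 := by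
  have hs := sq_two_pow_half hn
  have := h.mem hn habc
  simp only [Set.mem_insert_iff, Set.mem_singleton_iff] at this
  rw [hL]
  push_cast
  set s : ℤ := 2 ^ ((n + 1) / 2)
  set N : ℤ := 2 ^ n
  have h1 : s ^ 6 = 10 * N * s ^ 4 - 16 * N ^ 2 * s ^ 2 := by
    linear_combination s ^ 2 * (s ^ 2 - 8 * N) * hs
  have h2 : (2 * s) ^ 6 = 10 * N * (2 * s) ^ 4 - 16 * N ^ 2 * (2 * s) ^ 2 := by
    linear_combination 32 * s ^ 2 * (2 * s ^ 2 - N) * hs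
  rcases this with h | h | h | h | h <;> rw [h]
  · norm_num
  · exact h1
  · linear_combination h1
  · exact h2
  · linear_combination h2

/-- The count is squeezed between the tuples that cancel in pairs and the zero-sum tuples of x ↦ (x,
f x). The latter see only c = 0, where z⁴ = 2|L|z² makes the two bounds equal. -/
theorem WalshBound.card_four (hn : Odd n) (hL : Fintype.card L = 2 ^ n) (h : WalshBound n f g) :
    (#(zeroSumTuples (column f g) 4) : ℤ) = 3 * Fintype.card L ^ 2 - 2 * Fintype.card L := by
  classical
  obtain ⟨-, h4, -⟩ := card_zeroSumTuples_point (L := L)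
  have hsub : zeroSumTuples (column f g) 4 ⊆ zeroSumTuples (fun x => (x, f x)) 4 := by
    intro x hx
    rw [mem_zeroSumTuples] at hx ⊢
    have h1 := congrArg Prod.fst hx
    have h2 := congrArg (fun v => v.2.1) hx
    simp only [Prod.fst_sum, Prod.snd_sum, column] at h1 h2
    exact Prod.ext (by rw [Prod.fst_sum]; exact h1) (by rw [Prod.snd_sum]; exact h2)
  have hle1 := card_le_card (zeroSumTuples_point_subset (column f g) 4)
  have hle2 := card_le_card hsub
  have m2 := sum_fourier_pow_pair f g 2
  have m4 := sum_fourier_pow_pair f g 4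
  have hinj : Function.Injective fun x => (x, f x) := fun x y hxy => (Prod.mk.inj hxy).1
  rw [card_zeroSumTuples_two hinj] at m2
  rw [← add_sum_erase _ _ (mem_univ 0)] at m2 m4
  have hrest : ∑ t ∈ univ.erase (0 : L × L), fourier f g t.1 t.2 0 ^ 4 =
      2 * Fintype.card L * ∑ t ∈ univ.erase (0 : L × L), fourier f g t.1 t.2 0 ^ 2 := by
    rw [mul_sum]
    refine sum_congr rfl fun t ht => h.pow_four hn hL fun h0 => ?_
    exact (mem_erase.1 ht).1 (Prod.ext h0.1 h0.2)
  rw [hrest] at m4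
  simp only [Prod.fst_zero, Prod.snd_zero, fourier_zero] at m2 m4
  have hN : (Fintype.card L : ℤ) ≠ 0 := by simp
  have hpair : (#(zeroSumTuples (fun x => (x, f x)) 4) : ℤ) =
      3 * Fintype.card L ^ 2 - 2 * Fintype.card L := by
    refine mul_left_cancel₀ (pow_ne_zero 2 hN) ?_
    linear_combination 2 * Fintype.card L * m2 - m4
  zify at hle1 hle2
  omega

theorem WalshBound.zeroSumTuples_six (hn : Odd n) (hL : Fintype.card L = 2 ^ n)
    (h : WalshBound n f g) [DecidableEq L] :
    zeroSumTuples (column f g) 6 = zeroSumTuples (point (L := L)) 6 := by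
  classical
  obtain ⟨-, -, h6⟩ := card_zeroSumTuples_point (L := L)
  refine (eq_of_subset_of_card_le (zeroSumTuples_point_subset (column f g) 6) ?_).symm
  have m2 := sum_fourier_pow f g 2
  have m4 := sum_fourier_pow f g 4
  have m6 := sum_fourier_pow f g 6
  have hinj : Function.Injective (column f g) := fun x y hxy => (Prod.mk.inj hxy).1
  rw [card_zeroSumTuples_two hinj] at m2
  rw [h.card_four hn hL] at m4
  rw [← add_sum_erase _ _ (mem_univ 0)] at m2 m4 m6
  have hrest : ∑ t ∈ univ.erase (0 : L × L × L), fourier f g t.1 t.2.1 t.2.2 ^ 6 =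
      10 * Fintype.card L * ∑ t ∈ univ.erase (0 : L × L × L), fourier f g t.1 t.2.1 t.2.2 ^ 4 -
      16 * Fintype.card L ^ 2 *
        ∑ t ∈ univ.erase (0 : L × L × L), fourier f g t.1 t.2.1 t.2.2 ^ 2 := by
    rw [mul_sum, mul_sum, ← sum_sub_distrib]
    refine sum_congr rfl fun t ht => h.pow_six hn hL fun h0 => ?_
    exact (mem_erase.1 ht).1 (Prod.ext h0.1 (Prod.ext h0.2.1 h0.2.2))
  rw [hrest] at m6
  simp only [Prod.fst_zero, Prod.snd_zero, fourier_zero] at m2 m4 m6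
  have hN : (Fintype.card L : ℤ) ≠ 0 := by simp
  have : (#(zeroSumTuples (column f g) 6) : ℤ) =
      15 * Fintype.card L ^ 3 - 30 * Fintype.card L ^ 2 + 16 * Fintype.card L := by
    refine mul_left_cancel₀ (pow_ne_zero 3 hN) ?_
    linear_combination 10 * Fintype.card L * m4 - 16 * Fintype.card L ^ 2 * m2 - m6
  rw [← h6] at this
  exact_mod_cast this.le

/-- Among at most six elements whose columns sum to zero, every nonzero value occurs an even
number of times. -/
theorem WalshBound.sum_column_eq_zero_iff (hn : Odd n) (hL : Fintype.card L = 2 ^ n)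
    (h : WalshBound n f g) (hf : f 0 = 0) (hg : g 0 = 0) [DecidableEq L] {ι : Type*} [Fintype ι]
    (hι : Fintype.card ι ≤ 6) (x : ι → L) :
    ∑ i, column f g (x i) = 0 ↔ ∀ y ≠ 0, (∑ i, point (x i)) y = 0 := by
  have hc0 : column f g 0 = 0 := by rw [column, hf, hg]; rfl
  constructor
  · intro hx y hy
    -- Padding with zeros to six entries is harmless as the column at 0 vanishes, but it loses the
    -- parity of the value 0.
    let κ := ι ⊕ Fin (6 - Fintype.card ι)
    have hκ : Fintype.card κ = 6 := by
      rw [Fintype.card_sum, Fintype.card_fin]; omega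
    let e : Fin 6 ≃ κ := (Fintype.equivFinOfCardEq hκ).symm
    let z : κ → L := Sum.elim x fun _ => 0
    have hz : (fun i => z (e i)) ∈ zeroSumTuples (column f g) 6 := by
      rw [mem_zeroSumTuples, Equiv.sum_comp e fun i => column f g (z i), Fintype.sum_sum_type]
      simp [z, hx, hc0]
    rw [h.zeroSumTuples_six hn hL, mem_zeroSumTuples,
      Equiv.sum_comp e fun i => point (z i), Fintype.sum_sum_type] at hz
    have := congrFun hz y
    simpa [z, point, hy] using this
  · intro hx
    rw [sum_eq_sum_smul]
    refine sum_eq_zero fun y _ => ?_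
    by_cases hy : y = 0
    · rw [hy, hc0, smul_zero]
    · rw [hx y hy, zero_smul]

/-- The first moments of the Walsh transform do not depend on the pair of functions. -/
theorem WalshBound.sum_fourier_pow_eq (hn : Odd n) (hL : Fintype.card L = 2 ^ n)
    (h : WalshBound n f g) (hf : f 0 = 0) (hg : g 0 = 0) {f' g' : L → L}
    (h' : WalshBound n f' g') (hf' : f' 0 = 0) (hg' : g' 0 = 0) {j : ℕ} (hj : j ≤ 6) :
    ∑ t : L × L × L, fourier f g t.1 t.2.1 t.2.2 ^ j =
      ∑ t : L × L × L, fourier f' g' t.1 t.2.1 t.2.2 ^ j := by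
  classical
  rw [sum_fourier_pow, sum_fourier_pow]
  congr 3
  ext x
  rw [mem_zeroSumTuples, mem_zeroSumTuples,
    h.sum_column_eq_zero_iff hn hL hf hg (by simpa using hj),
    h'.sum_column_eq_zero_iff hn hL hf' hg' (by simpa using hj)]

/-- The value distribution of the Walsh transform does not depend on the pair of functions. -/
theorem WalshBound.sum_comp_fourier_eq (hn : Odd n) (hL : Fintype.card L = 2 ^ n)
    (h : WalshBound n f g) (hf : f 0 = 0) (hg : g 0 = 0) {f' g' : L → L}
    (h' : WalshBound n f' g') (hf' : f' 0 = 0) (hg' : g' 0 = 0) (F : ℤ → ℤ) :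
    ∑ t : L × L × L, F (fourier f g t.1 t.2.1 t.2.2) =
      ∑ t : L × L × L, F (fourier f' g' t.1 t.2.1 t.2.2) := by
  classical
  set s : ℤ := 2 ^ ((n + 1) / 2) with hs
  let A : Finset ℤ := {0, s, -s, 2 * s, -(2 * s)}
  have hA : #A ≤ 5 := card_le_five
  -- On at most five values `F` agrees with a polynomial of degree below 5, so moments of order at
  -- most 4 suffice. The origin, with value |L| possibly outside `A`, is corrected separately in
  -- `hsum`.
  let p := Lagrange.interpolate A (fun z : ℤ => (z : ℚ)) fun z => (F z : ℚ)
  have hinj : Set.InjOn (fun z : ℤ => (z : ℚ)) A := Int.cast_injective.injOn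
  have hdeg : p.natDegree < 5 := by
    have h1 := (Lagrange.degree_interpolate_lt (fun z => (F z : ℚ)) hinj).trans_le
      (Nat.cast_le.2 hA)
    by_cases hp : p = 0
    · rw [hp, Polynomial.natDegree_zero]; norm_num
    · exact (Polynomial.natDegree_lt_iff_degree_lt hp).2 h1
  have hev : ∀ z ∈ A, p.eval (z : ℚ) = F z := fun z hz =>
    Lagrange.eval_interpolate_at_node _ hinj hz
  have hmem : ∀ {f g : L → L}, WalshBound n f g → ∀ t ∈ univ.erase (0 : L × L × L),
      fourier f g t.1 t.2.1 t.2.2 ∈ A := by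
    intro f g h t ht
    have := h.mem hn (a := t.1) (b := t.2.1) (c := t.2.2) fun h0 =>
      (mem_erase.1 ht).1 (Prod.ext h0.1 (Prod.ext h0.2.1 h0.2.2))
    simpa [A] using this
  have hsum : ∀ {f g : L → L}, WalshBound n f g →
      ((∑ t : L × L × L, F (fourier f g t.1 t.2.1 t.2.2) : ℤ) : ℚ) =
        F (Fintype.card L) - p.eval (Fintype.card L : ℚ) + ∑ j ∈ range 5, p.coeff j *
          ((∑ t : L × L × L, fourier f g t.1 t.2.1 t.2.2 ^ j : ℤ) : ℚ) := by
    intro f g h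
    have h1 : ∑ j ∈ range 5, p.coeff j *
        ((∑ t : L × L × L, fourier f g t.1 t.2.1 t.2.2 ^ j : ℤ) : ℚ) =
        ∑ t : L × L × L, p.eval (fourier f g t.1 t.2.1 t.2.2 : ℚ) := by
      push_cast
      simp_rw [mul_sum]
      rw [sum_comm]
      exact sum_congr rfl fun t _ => (Polynomial.eval_eq_sum_range' hdeg _).symm
    rw [h1]
    push_cast
    rw [← add_sum_erase _ _ (mem_univ 0), ← add_sum_erase univ (fun t : L × L × L => p.eval _)
      (mem_univ 0), sum_congr rfl fun t ht => hev _ (hmem h t ht)]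
    simp only [Prod.fst_zero, Prod.snd_zero, fourier_zero]
    push_cast
    ring
  have := hsum h
  have hmom : ∀ j ∈ range 5, p.coeff j *
      ((∑ t : L × L × L, fourier f g t.1 t.2.1 t.2.2 ^ j : ℤ) : ℚ) =
      p.coeff j * ((∑ t : L × L × L, fourier f' g' t.1 t.2.1 t.2.2 ^ j : ℤ) : ℚ) := by
    intro j hj
    rw [h.sum_fourier_pow_eq hn hL hf hg h' hf' hg' (by rw [mem_range] at hj; omega)]
  rw [sum_congr rfl hmom, ← hsum h'] at this
  exact_mod_cast this

end Moments
end TripleCode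

/-! ### From the Walsh transform to the code -/

namespace TripleCode

section Code

open Finset

theorem sum_eq_add_sum_units {L M : Type*} [Field L] [Fintype L] [DecidableEq L]
    [AddCommMonoid M] (h : L → M) :
    ∑ x : L, h x = h 0 + ∑ x : Lˣ, h (x : L) := by
  rw [← add_sum_erase univ _ (mem_univ (0 : L))]
  congr 1
  refine (sum_bij (fun (x : Lˣ) _ => (x : L)) ?_ ?_ ?_ fun _ _ => rfl).symm
  · intro x _; simp
  · intro x _ y _ hxy; exact Units.ext hxy
  · intro x hx; exact ⟨Units.mk0 x (by simpa using hx), mem_univ _, rfl⟩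

variable {L : Type*} [Field L] [Algebra (ZMod 2) L]

/-- The pairing `⟨t, v⟩ ↦ Tr (t₁ v₁ + t₂ v₂ + t₃ v₃)`. -/
noncomputable def pairing (t : L × L × L) : L × L × L →ₗ[ZMod 2] ZMod 2 :=
  tr ∘ₗ (LinearMap.mulLeft (ZMod 2) t.1 ∘ₗ LinearMap.fst _ _ _ +
    LinearMap.mulLeft (ZMod 2) t.2.1 ∘ₗ LinearMap.fst _ _ _ ∘ₗ LinearMap.snd _ _ _ +
    LinearMap.mulLeft (ZMod 2) t.2.2 ∘ₗ LinearMap.snd _ _ _ ∘ₗ LinearMap.snd _ _ _)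

theorem pairing_apply (t v : L × L × L) :
    pairing t v = tr (t.1 * v.1 + t.2.1 * v.2.1 + t.2.2 * v.2.2) := rfl

variable [Fintype L]

theorem sum_sgn_pairing [DecidableEq L] (v : L × L × L) :
    ∑ t, sgn (pairing t v) = if v = 0 then (Fintype.card L : ℤ) ^ 3 else 0 := by
  simp_rw [pairing_apply]
  split_ifs with h
  · simp [h, sgn_zero]; ring
  · exact sum_sgn_tr_triple h

/-- The bound on n is needed for the size comparison: at n = 3 the value 2^((n+3)/2) equals |L|. -/
theorem WalshBound.fourier_ne_card {n : ℕ} (hn5 : 5 ≤ n) (hL : Fintype.card L = 2 ^ n)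
    {f g : L → L} (h : WalshBound n f g) {a b c : L} (habc : ¬(a = 0 ∧ b = 0 ∧ c = 0)) :
    fourier f g a b c ≠ Fintype.card L := by
  have h0 : (0 : ℤ) < 2 ^ n := by positivity
  have h1 : (2 : ℤ) ^ ((n + 1) / 2) < 2 ^ n := pow_lt_pow_right₀ (by norm_num) (by omega)
  have h3 : (2 : ℤ) ^ ((n + 3) / 2) < 2 ^ n := pow_lt_pow_right₀ (by norm_num) (by omega)
  have h1' : (0 : ℤ) < 2 ^ ((n + 1) / 2) := by positivity
  have h3' : (0 : ℤ) < 2 ^ ((n + 3) / 2) := by positivity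
  have := h a b c habc
  simp only [Set.mem_insert_iff, Set.mem_singleton_iff] at this
  rw [hL]
  push_cast
  omega

section Krawtchouk

variable {ι : Type*} [Fintype ι]

theorem sum_sgn_eq (τ : ι → ZMod 2) :
    ∑ x, sgn (τ x) = Fintype.card ι - 2 * Fintype.card {x // τ x = 1} := by
  have : ∀ x, sgn (τ x) = 1 - if τ x = 1 then 2 else 0 := by
    intro x
    rcases eq_zero_or_one (τ x) with h | h <;> rw [h] <;> simp [sgn_zero, sgn_one]
  simp_rw [this, sum_sub_distrib, ← sum_filter, Fintype.card_subtype]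
  simp [mul_comm]

theorem hammingNorm_comp_perm (π : Equiv.Perm ι) (u : ι → ZMod 2) :
    hammingNorm (u ∘ π) = hammingNorm u := by
  simp only [hammingNorm, Function.comp_apply]
  rw [← card_map π.toEmbedding]
  congr 1
  ext x
  simp only [mem_map, mem_filter, mem_univ, true_and, Equiv.coe_toEmbedding]
  exact ⟨by rintro ⟨y, hy, rfl⟩; exact hy, fun hx => ⟨π.symm x, by simpa using hx, by simp⟩⟩

variable [DecidableEq ι]

/-- The character sum over the words of weight `w` depends only on the weight of the character. -/
theorem exists_krawtchouk (w : ℕ) : ∃ F : ℤ → ℤ, ∀ τ : ι → ZMod 2,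
    ∑ u : ι → ZMod 2 with hammingNorm u = w, sgn (∑ x, u x * τ x) = F (∑ x, sgn (τ x)) := by
  have key : Function.FactorsThrough
      (fun τ : ι → ZMod 2 => ∑ u : ι → ZMod 2 with hammingNorm u = w, sgn (∑ x, u x * τ x))
      (fun τ => ∑ x, sgn (τ x)) := by
    intro τ τ' h
    simp only [sum_sgn_eq] at h
    have hcard : Fintype.card {x // τ x = 1} = Fintype.card {x // τ' x = 1} := by omega
    let e := Fintype.equivOfCardEq hcard
    -- Characters of equal weight differ by a permutation of coordinates, and this permutes the
    -- words of weight `w`.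
    let π : Equiv.Perm ι := e.extendSubtype
    have hπ : ∀ x, τ' (π x) = τ x := by
      intro x
      rcases eq_zero_or_one (τ x) with hx | hx
      · have : ¬ τ' (π x) = 1 := e.extendSubtype_not_mem x (by rw [hx]; decide)
        rw [hx]
        exact (eq_zero_or_one _).resolve_right this
      · rw [hx]
        exact e.extendSubtype_mem x hx
    refine (sum_bij (fun u _ => u ∘ π) ?_ ?_ ?_ ?_).symm
    · intro u hu
      simpa [hammingNorm_comp_perm] using hu
    · intro u _ v _ huv
      exact π.surjective.injective_comp_right huv
    · intro v hv
      refine ⟨v ∘ π.symm, ?_, ?_⟩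
      · simpa [hammingNorm_comp_perm] using hv
      · ext x; simp
    · intro u _
      rw [← Equiv.sum_comp π fun x => u x * τ' x]
      simp [hπ]
  obtain ⟨F, hF⟩ := (Function.factorsThrough_iff _).1 key
  exact ⟨F, fun τ => congrFun hF τ⟩

theorem sum_sgn_mul_eq_zero {τ : ι → ZMod 2} (hτ : τ ≠ 0) :
    ∑ u : ι → ZMod 2, sgn (∑ x, u x * τ x) = 0 := by
  obtain ⟨y, hy⟩ := Function.ne_iff.1 hτ
  have hy1 := (eq_zero_or_one (τ y)).resolve_left hy
  have := Equiv.sum_comp (Equiv.addRight (Pi.single y 1 : ι → ZMod 2))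
    fun u => sgn (∑ x, u x * τ x)
  simp only [Equiv.coe_addRight, Pi.add_apply, add_mul, sum_add_distrib, sgn_add,
    ← sum_mul] at this
  have h1 : ∑ x, (Pi.single y 1 : ι → ZMod 2) x * τ x = 1 := by
    simp [Pi.single_apply, hy1]
  rw [h1, sgn_one] at this
  linarith

end Krawtchouk

variable [DecidableEq L] {n : ℕ} (B : Module.Basis (Fin n) (ZMod 2) L) {f g : L → L}

theorem mem_code_iff (u : Lˣ → ZMod 2) :
    u ∈ code B f g ↔ ∑ x : Lˣ, u x • column f g (x : L) = 0 := by
  have hrow : ∀ h : L → L, (∀ j, ∑ x : Lˣ, B.repr (h x) j * u x = 0) ↔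
      ∑ x : Lˣ, u x • h x = 0 := by
    intro h
    rw [← B.repr.map_eq_zero_iff, map_sum, Finsupp.ext_iff]
    simp [Finsupp.finsetSum_apply, mul_comm]
  have h1 := hrow fun x => x
  have h2 := hrow f
  have h3 := hrow g
  rw [code, LinearMap.mem_ker, Matrix.mulVecLin_apply, funext_iff, Prod.forall,
    Fin.forall_fin_succ, Fin.forall_fin_two]
  simp only [parityCheck, Matrix.mulVec, dotProduct, Matrix.of_apply, Pi.zero_apply]
  rw [Prod.ext_iff, Prod.ext_iff]
  simp only [Prod.fst_sum, Prod.snd_sum, Prod.smul_fst, Prod.smul_snd, column, Prod.fst_zero,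
    Prod.snd_zero]
  rw [← h1, ← h2, ← h3]
  rfl

/-- A support of at most six points would list distinct nonzero elements with zero column sum, each
occurring once, an odd number of times. -/
theorem WalshBound.seven_le_hammingNorm (hn : Odd n) (hL : Fintype.card L = 2 ^ n)
    (h : WalshBound n f g) (hf : f 0 = 0) (hg : g 0 = 0) {u : Lˣ → ZMod 2}
    (hu : u ∈ code B f g) (hu0 : u ≠ 0) : 7 ≤ hammingNorm u := by
  by_contra! hlt
  rw [mem_code_iff] at hu
  have hcard : Fintype.card {x : Lˣ // u x ≠ 0} = hammingNorm u := by
    rw [Fintype.card_subtype]; rfl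
  have hsum : ∑ x : {x : Lˣ // u x ≠ 0}, column f g (x.1 : L) = 0 := by
    rw [← hu, ← sum_subtype (univ.filter fun x : Lˣ => u x ≠ 0) (by simp)
      fun x : Lˣ => column f g (x : L), sum_filter]
    refine sum_congr rfl fun x _ => ?_
    rcases eq_zero_or_one (u x) with hx | hx <;> simp [hx]
  obtain ⟨y, hy⟩ := Function.ne_iff.1 hu0
  have key := (h.sum_column_eq_zero_iff hn hL hf hg (by omega)
    fun x : {x : Lˣ // u x ≠ 0} => (x.1 : L)).1 hsum y y.ne_zero
  rw [sum_point_apply, sum_eq_single ⟨y, hy⟩] at key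
  · simp at key
  · intro x _ hx
    rw [if_neg]
    exact fun hxy => hx (Subtype.ext (Units.ext hxy))
  · simp

/-- Summing the characters over all triples (a, b, c) detects a zero syndrome. This replaces
MacWilliams' identity and remains valid when different triples give the same dual word. -/
theorem card_mul_card_filter_mem_code (U : Finset (Lˣ → ZMod 2)) :
    (Fintype.card L : ℤ) ^ 3 * Set.ncard {u | u ∈ code B f g ∧ u ∈ U} =
      ∑ t, ∑ u ∈ U, sgn (∑ x : Lˣ, u x * pairing t (column f g (x : L))) := by
  have hpair : ∀ t (u : Lˣ → ZMod 2), ∑ x : Lˣ, u x * pairing t (column f g (x : L)) =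
      pairing t (∑ x : Lˣ, u x • column f g (x : L)) := by
    intro t u
    rw [map_sum]
    simp only [map_smul, smul_eq_mul]
  simp_rw [hpair]
  rw [sum_comm]
  simp_rw [sum_sgn_pairing]
  rw [← sum_filter, sum_const, nsmul_eq_mul, mul_comm]
  congr 2
  rw [← Set.ncard_coe_finset]
  congr 1
  ext u
  simp [mem_code_iff, and_comm]

theorem sum_units_sgn_pairing (hf : f 0 = 0) (hg : g 0 = 0) (t : L × L × L) :
    ∑ x : Lˣ, sgn (pairing t (column f g (x : L))) = fourier f g t.1 t.2.1 t.2.2 - 1 := by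
  have h0 : fourier f g t.1 t.2.1 t.2.2 = ∑ x : L, sgn (pairing t (column f g x)) := rfl
  rw [h0, sum_eq_add_sum_units fun x : L => sgn (pairing t (column f g x))]
  have h1 : sgn (pairing t (column f g 0)) = 1 := by
    simp [pairing_apply, column, hf, hg, sgn_zero]
  rw [h1, add_sub_cancel_left]

theorem WalshBound.weightCount_eq (hn : Odd n) (hL : Fintype.card L = 2 ^ n)
    (h : WalshBound n f g) (hf : f 0 = 0) (hg : g 0 = 0) {f' g' : L → L}
    (h' : WalshBound n f' g') (hf' : f' 0 = 0) (hg' : g' 0 = 0) (w : ℕ) :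
    weightCount (code B f g) w = weightCount (code B f' g') w := by
  obtain ⟨F, hF⟩ := exists_krawtchouk (ι := Lˣ) w
  have key : ∀ {f g : L → L}, f 0 = 0 → g 0 = 0 →
      (Fintype.card L : ℤ) ^ 3 * weightCount (code B f g) w =
        ∑ t : L × L × L, F (fourier f g t.1 t.2.1 t.2.2 - 1) := by
    intro f g hf hg
    have := card_mul_card_filter_mem_code B (f := f) (g := g)
      (univ.filter fun u => hammingNorm u = w)
    simp_rw [hF, sum_units_sgn_pairing hf hg] at this
    rw [← this, weightCount]
    simp
  have h1 := key hf hg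
  rw [h.sum_comp_fourier_eq hn hL hf hg h' hf' hg' fun z => F (z - 1), ← key hf' hg'] at h1
  have hN : (Fintype.card L : ℤ) ≠ 0 := by simp
  exact_mod_cast mul_left_cancel₀ (pow_ne_zero 3 hN) h1

/-- Only the zero triple contributes when all words are counted: a nonzero triple with trivial
character would have Walsh value |L|. -/
theorem WalshBound.finrank_code (hn5 : 5 ≤ n) (hL : Fintype.card L = 2 ^ n)
    (h : WalshBound n f g) (hf : f 0 = 0) (hg : g 0 = 0) :
    3 * n + Module.finrank (ZMod 2) (code B f g) = 2 ^ n - 1 := by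
  have hcard : Fintype.card Lˣ = 2 ^ n - 1 := by rw [Fintype.card_units, hL]
  have key := card_mul_card_filter_mem_code B (f := f) (g := g) univ
  rw [← add_sum_erase _ _ (mem_univ 0), sum_eq_zero (s := univ.erase 0)] at key
  · have h0 : pairing (0 : L × L × L) = 0 := by ext <;> simp [pairing_apply]
    have hnc : Set.ncard {u | u ∈ code B f g ∧ u ∈ (univ : Finset (Lˣ → ZMod 2))} =
        2 ^ Module.finrank (ZMod 2) (code B f g) := by
      have := Module.natCard_eq_pow_finrank (K := ZMod 2) (V := code B f g)
      rw [Nat.card_zmod] at this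
      rw [← this]
      simp only [mem_univ, and_true]
      rfl
    rw [hnc, h0, hL] at key
    simp only [LinearMap.zero_apply, mul_zero, sum_const_zero, sgn_zero, sum_const, card_univ,
      Fintype.card_fun, ZMod.card, hcard, nsmul_eq_mul, mul_one, add_zero] at key
    rw [← hcard] at key ⊢
    have key' : (2 ^ n) ^ 3 * 2 ^ Module.finrank (ZMod 2) (code B f g) =
        2 ^ Fintype.card Lˣ := by exact_mod_cast key
    rw [← pow_mul, ← pow_add] at key'
    rw [mul_comm]
    exact Nat.pow_right_injective le_rfl key'
  · intro t ht
    refine sum_sgn_mul_eq_zero fun hτ => ?_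
    refine h.fourier_ne_card hn5 hL (a := t.1) (b := t.2.1) (c := t.2.2) (fun h0 =>
      (mem_erase.1 ht).1 (Prod.ext h0.1 (Prod.ext h0.2.1 h0.2.2))) ?_
    have h1 := sum_units_sgn_pairing hf hg t
    rw [sum_congr rfl fun x _ => congrArg sgn (congrFun hτ x)] at h1
    simp only [Pi.zero_apply, sgn_zero] at h1
    rw [sum_const, card_univ, hcard] at h1
    have h2 : 1 ≤ 2 ^ n := Nat.one_le_two_pow
    rw [hL]
    simp only [nsmul_eq_mul, mul_one] at h1
    push_cast [Nat.cast_sub h2] at h1 ⊢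
    linarith

end Code

/-! ### A BCH word of weight 7 and the minimum distance -/

section BCH

open Finset Module

variable {L : Type*} [Field L] [Fintype L] [Algebra (ZMod 2) L]

/-- Products of two linear maps sum to zero over a three-dimensional binary space. -/
theorem sum_mul_eq_zero_of_finrank_eq_three (V : Submodule (ZMod 2) L) [Fintype V]
    (hV : finrank (ZMod 2) V = 3) (p q : L →ₗ[ZMod 2] L) : ∑ x : V, p x * q x = 0 := by
  let bas := finBasisOfFinrankEq (ZMod 2) V hV
  rw [← Equiv.sum_comp bas.equivFun.symm.toEquiv]
  have hexp : ∀ (r : L →ₗ[ZMod 2] L) (c : Fin 3 → ZMod 2),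
      r (bas.equivFun.symm c : V) = ∑ i, c i • r (bas i) := by
    intro r c
    rw [Basis.equivFun_symm_apply]
    simp
  have hc : ∀ i j : Fin 3, ∑ c : Fin 3 → ZMod 2, c i * c j = 0 := by decide
  calc _ = ∑ c : Fin 3 → ZMod 2, ∑ i, ∑ j, (c i * c j) • (p (bas i) * q (bas j)) := by
        refine sum_congr rfl fun c _ => ?_
        rw [LinearEquiv.coe_toEquiv, hexp, hexp, sum_mul_sum]
        simp_rw [smul_mul_smul_comm]
    _ = ∑ i, ∑ j, (∑ c : Fin 3 → ZMod 2, c i * c j) • (p (bas i) * q (bas j)) := by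
        rw [sum_comm]
        refine sum_congr rfl fun i _ => ?_
        rw [sum_comm]
        simp_rw [sum_smul]
    _ = 0 := by simp [hc]

/-- The nonzero elements of a three-dimensional subspace form a word of weight `7` in the BCH
code. -/
theorem exists_bchCode_hammingNorm_eq_seven [DecidableEq L] {n : ℕ} (hn : 3 ≤ n)
    (B : Basis (Fin n) (ZMod 2) L) : ∃ u ∈ bchCode B, hammingNorm u = 7 := by
  classical
  let V := Submodule.span (ZMod 2) (Set.range fun i : Fin 3 => B (Fin.castLE hn i))
  have hV : finrank (ZMod 2) V = 3 := by
    rw [finrank_span_eq_card, Fintype.card_fin]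
    exact B.linearIndependent.comp _ (Fin.castLE_injective hn)
  have hsum : ∑ x : Lˣ, (if (x : L) ∈ V then (1 : ZMod 2) else 0) •
      column (fun x => x ^ 3) (fun x => x ^ 5) (x : L) =
      ∑ x : V, column (fun x => x ^ 3) (fun x => x ^ 5) (x : L) := by
    have h := sum_eq_add_sum_units fun x : L => (if x ∈ V then (1 : ZMod 2) else 0) •
      column (fun x => x ^ 3) (fun x => x ^ 5) x
    have h0 : column (fun x => x ^ 3) (fun x => x ^ 5) (0 : L) = 0 := by simp [column]
    rw [h0, smul_zero, zero_add] at h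
    rw [← h, ← sum_subtype (univ.filter fun x : L => x ∈ V) (by simp)
      fun x : L => column (fun x => x ^ 3) (fun x => x ^ 5) x, sum_filter]
    simp only [ite_smul, one_smul, zero_smul]
  refine ⟨fun x => if (x : L) ∈ V then 1 else 0, ?_, ?_⟩
  · rw [bchCode, mem_code_iff, hsum]
    have key := sum_mul_eq_zero_of_finrank_eq_three V hV
    -- Each coordinate is a product of two additive maps: x = √x · √x, x³ = x · x², x⁵ = x · x⁴.
    have h1 := key (frob L).symm.toLinearMap (frob L).symm.toLinearMap
    have h3 := key LinearMap.id (frob L ^ 1).toLinearMap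
    have h5 := key LinearMap.id (frob L ^ 2).toLinearMap
    have e1 : ∀ x : L, (frob L).symm x * (frob L).symm x = x := by
      intro x
      have h := frob_pow_apply 1 ((frob L).symm x)
      rw [pow_one, AlgEquiv.apply_symm_apply, pow_one, pow_two] at h
      exact h.symm
    simp only [AlgEquiv.toLinearMap_apply, LinearMap.id_apply, e1, frob_pow_apply,
      ← pow_succ'] at h1 h3 h5
    refine Prod.ext ?_ (Prod.ext ?_ ?_)
    · simpa [Prod.fst_sum, column] using h1
    · simpa [Prod.fst_sum, Prod.snd_sum, column] using h3
    · simpa [Prod.fst_sum, Prod.snd_sum, column] using h5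
  · have hcV := Module.card_eq_pow_finrank (K := ZMod 2) (V := V)
    rw [hV, ZMod.card, Fintype.card_subtype, card_filter,
      sum_eq_add_sum_units fun x : L => if x ∈ V then 1 else 0, if_pos V.zero_mem] at hcV
    simp only [hammingNorm, card_filter, ite_ne_right_iff, ne_eq, one_ne_zero, not_false_eq_true,
      and_true]
    omega

end BCH

theorem WalshBound.hasMinDist {L : Type*} [Field L] [Fintype L] [DecidableEq L]
    [Algebra (ZMod 2) L] {n : ℕ} (hn : Odd n) (hn3 : 3 ≤ n) (hL : Fintype.card L = 2 ^ n)
    (B : Module.Basis (Fin n) (ZMod 2) L) {f g : L → L} (h : WalshBound n f g) (hf : f 0 = 0)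
    (hg : g 0 = 0) : HasMinDist (code B f g) 7 := by
  constructor
  · have hw := h.weightCount_eq B hn hL hf hg (fourier_bch hn hL) (by simp) (by simp) 7
    obtain ⟨v, hv, hv7⟩ := exists_bchCode_hammingNorm_eq_seven hn3 B
    have hpos : weightCount (code B f g) 7 ≠ 0 := by
      rw [hw]
      have hne : {u | u ∈ bchCode B ∧ hammingNorm u = 7}.Nonempty := ⟨v, hv, hv7⟩
      exact ((Set.ncard_pos (Set.toFinite _)).2 hne).ne'
    obtain ⟨u, hu, hu7⟩ := Set.nonempty_of_ncard_ne_zero hpos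
    refine ⟨u, hu, 0, Submodule.zero_mem _, ?_, by rw [hammingDist_zero_right, hu7]⟩
    rintro rfl
    simp at hu7
  · rintro m ⟨u, hu, v, hv, huv, rfl⟩
    rw [hammingDist_eq_hammingNorm]
    have hmem : -u + v ∈ code B f g := Submodule.add_mem _ (Submodule.neg_mem _ hu) hv
    exact h.seven_le_hammingNorm B hn hL hf hg hmem fun h0 => huv (neg_add_eq_zero.1 h0)

end TripleCode

theorem theorem2 (n k : ℕ) (hn : Odd n) (hk : Nat.Coprime k n)
    {L : Type*} [Field L] [Fintype L] [DecidableEq L] [Algebra (ZMod 2) L]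
    (hL : Fintype.card L = 2 ^ n) (B : Module.Basis (Fin n) (ZMod 2) L) :
    (∀ a b c : L, ¬(a = 0 ∧ b = 0 ∧ c = 0) →
      TripleCode.fourier (TripleCode.powF k) (TripleCode.powG k) a b c ∈
        ({0, 2 ^ ((n + 1) / 2), -2 ^ ((n + 1) / 2), 2 ^ ((n + 3) / 2), -2 ^ ((n + 3) / 2)} :
          Set ℤ)) ∧
    (3 ≤ n → TripleCode.HasMinDist
      (TripleCode.code B (TripleCode.powF k) (TripleCode.powG k)) 7) ∧
    (5 ≤ n → TripleCode.HasParameters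
      (TripleCode.code B (TripleCode.powF k) (TripleCode.powG k))
        (2 ^ n - 1) (2 ^ n - 3 * n - 1) 7) ∧
    (∀ w : ℕ, TripleCode.weightCount
      (TripleCode.code B (TripleCode.powF k) (TripleCode.powG k)) w =
        TripleCode.weightCount (TripleCode.bchCode B) w) := by
  have hW : TripleCode.WalshBound n (TripleCode.powF k : L → L) (TripleCode.powG k) :=
    TripleCode.fourier_kasami hn hk hL
  have hf : (TripleCode.powF k : L → L) 0 = 0 := by simp [TripleCode.powF]
  have hg : (TripleCode.powG k : L → L) 0 = 0 := by simp [TripleCode.powG]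
  refine ⟨fun a b c habc => ?_, fun hn3 => hW.hasMinDist hn hn3 hL B hf hg, fun hn5 => ⟨?_, ?_,
    hW.hasMinDist hn (by omega) hL B hf hg⟩, fun w => ?_⟩
  · have := hW a b c habc
    simp only [Set.mem_insert_iff, Set.mem_singleton_iff] at this ⊢
    tauto
  · rw [Fintype.card_units, hL]
  · have := hW.finrank_code B hn5 hL hf hg
    omega
  · exact hW.weightCount_eq B hn hL hf hg (TripleCode.fourier_bch hn hL) (by simp) (by simp) w
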